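/- Let $a,b,c$ be real polynomials and $\alpha>0$ with $a(x)\ge\alpha$ for all $x\in[0,1]$. Consider the autonomous PDE $$w_t(x,t)=a(x)w_{xx}(x,t)+b(x)w_x(x,t)+c(x)w(x,t),\qquad w(0,t)=0,\quad w_x(1,t)=0,$$ and let $\mathcal D_0=\{y\in H^2(0,1): y(0)=y_x(1)=0\}$. A classical solution is a function $w:[0,\infty)\to L_2(0,1)$, continuous on $[0,\infty)$ and continuously differentiable on $(0,\infty)$, with $w(t)\in\mathcal D_0$ and $\dot w(t)=a\,w_{xx}(t)+b\,w_x(t)+c\,w(t)$ for all $t>0$. For $d_1,d_2\in\mathbb N$ let $Z_1(x)$ be the vector of the monomials in $x$ of degree at most $d_1$, starting with $1$, and $Z_2(x,\xi)$ the vector of the monomials in $(x,\xi)$ of degree at most $d_2$. For $\epsilon\ge 0$ let $\Xi_{d_1,d_2,\epsilon}$ be the set of the triples $\{M,K_1,K_2\}$ of polynomials for which there are real matrices $P_{ij}$, $1\le i,j\le 3$, with $P_{ji}=P_{ij}^T$, such that the symmetric block matrix $(P_{ij})$ stays positive semidefinite after $\epsilon$ is subtracted from its $(1,1)$ entry, and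 $$M(x)=Z_1(x)^TP_{11}Z_1(x),\qquad K_2(x,\xi)=K_1(\xi,x),$$ $$K_1(x,\xi)=Z_1(x)^TP_{12}Z_2(x,\xi)+Z_2(\xi,x)^TP_{31}Z_1(\xi)+\int_0^{\xi}Z_2(\eta,x)^TP_{33}Z_2(\eta,\xi)\,d\eta+\int_{\xi}^{x}Z_2(\eta,x)^TP_{32}Z_2(\eta,\xi)\,d\eta+\int_x^1Z_2(\eta,x)^TP_{22}Z_2(\eta,\xi)\,d\eta .$$ Let $\{\hat M,\hat K_1,\hat K_2\}=\Omega_s(M,K_1,K_2)$ be given by $$\hat M(x)=\partial_x\big[\partial_x(a(x)M(x))-b(x)M(x)\big]+2\big[\partial_x\big(a(x)(K_1(x,\xi)-K_2(x,\xi))\big)\big]_{\xi=x}+2M(x)c(x)-\tfrac{\pi^2}{2}\alpha\epsilon,$$ $$\hat K_1(x,\xi)=\partial_x\big[\partial_x(a(x)K_1(x,\xi))-b(x)K_1(x,\xi)\big]+\partial_\xi\big[\partial_\xi(a(\xi)K_1(x,\xi))-b(\xi)K_1(x,\xi)\big]+(c(x)+c(\xi))K_1(x,\xi),$$ and $\hat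 K_2(x,\xi)=\hat K_1(\xi,x)$. Suppose that there are scalars $\epsilon,\delta>0$, numbers $d_1,d_2,\hat d_1,\hat d_2\in\mathbb N$ and polynomials $M,K_1,K_2$ such that $$\{M,K_1,K_2\}\in\Xi_{d_1,d_2,\epsilon},\qquad \{-\hat M-2\delta M,\,-\hat K_1-2\delta K_1,\,-\hat K_2-2\delta K_2\}\in\Xi_{\hat d_1,\hat d_2,0},$$ $$(b(1)-a_x(1))K_1(1,x)-a(1)(\partial_1K_1)(1,x)=0\quad(x\in[0,1]),$$ $$(b(1)-a_x(1))M(1)-a(1)M_x(1)\le 0,\qquad K_2(0,x)=0\quad(x\in[0,1]).$$ Then there is a scalar $\gamma>0$ such that every classical solution $w$ with $w(0)\in\mathcal D_0$ satisfies $$\|w(t)\|_{L_2}\le\gamma\,\|w(0)\|_{L_2}\,e^{-\delta t},\qquad t>0 .$$ -/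

import Mathlib

open MeasureTheory Set
open scoped Matrix Polynomial

namespace ParabolicLMI

noncomputable section

/-! ### Polynomials in one and in two variables -/

/-- Real polynomials in the two variables `x` (index `0`) and `ξ` (index `1`). -/
abbrev BiPoly := MvPolynomial (Fin 2) ℝ

/-- The value `K(x, ξ)`. -/
def BiPoly.at (K : BiPoly) (x ξ : ℝ) : ℝ := MvPolynomial.eval ![x, ξ] K

/-- The polynomial `K(ξ, x)`. -/
def BiPoly.flip (K : BiPoly) : BiPoly := MvPolynomial.rename (Equiv.swap (0 : Fin 2) 1) K

/-- The univariate polynomial `K(x, x)`. -/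
def BiPoly.diag (K : BiPoly) : ℝ[X] := MvPolynomial.aeval (fun _ => Polynomial.X) K

/-- `p(x)`, regarded as a polynomial in `(x, ξ)`. -/
def inX (p : ℝ[X]) : BiPoly := Polynomial.aeval (MvPolynomial.X (0 : Fin 2)) p

/-- `p(ξ)`, regarded as a polynomial in `(x, ξ)`. -/
def inXi (p : ℝ[X]) : BiPoly := Polynomial.aeval (MvPolynomial.X (1 : Fin 2)) p

/-- Partial derivative with respect to the first variable `x`. -/
def dX (K : BiPoly) : BiPoly := MvPolynomial.pderiv (0 : Fin 2) K

/-- Partial derivative with respect to the second variable `ξ`. -/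
def dXi (K : BiPoly) : BiPoly := MvPolynomial.pderiv (1 : Fin 2) K

/-! ### The cone of sum-of-squares triples -/

/-- Exponents of the monomials of degree at most `d` in two variables. -/
abbrev Mon2 (d : ℕ) := {p : Fin (d + 1) × Fin (d + 1) // (p.1 : ℕ) + (p.2 : ℕ) ≤ d}

/-- The vector of the monomials of degree at most `d` in one variable, starting with `1`. -/
def Z1 (d : ℕ) (x : ℝ) : Fin (d + 1) → ℝ := fun i => x ^ (i : ℕ)

/-- The vector of the monomials of degree at most `d` in two variables. -/
def Z2 (d : ℕ) (x ξ : ℝ) : Mon2 d → ℝ := fun p => x ^ (p.1.1 : ℕ) * ξ ^ (p.1.2 : ℕ)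

/-- `Xi d₁ d₂ ε` is the set of the triples `(M, K₁, K₂)` of polynomials that are generated by a
symmetric block matrix `P` such that `P`, with `ε` subtracted from its top left entry, is
positive semidefinite. -/
def Xi (d₁ d₂ : ℕ) (ε : ℝ) : Set (ℝ[X] × BiPoly × BiPoly) :=
  {T | ∃ (P₁₁ : Matrix (Fin (d₁ + 1)) (Fin (d₁ + 1)) ℝ)
      (P₁₂ P₁₃ : Matrix (Fin (d₁ + 1)) (Mon2 d₂) ℝ)
      (P₂₂ P₂₃ P₃₃ : Matrix (Mon2 d₂) (Mon2 d₂) ℝ),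
    (Matrix.fromBlocks (P₁₁ - Matrix.single 0 0 ε) (Matrix.fromCols P₁₂ P₁₃)
      (Matrix.fromRows P₁₂ᵀ P₁₃ᵀ) (Matrix.fromBlocks P₂₂ P₂₃ P₂₃ᵀ P₃₃)).PosSemidef ∧
    (∀ x : ℝ, T.1.eval x = Z1 d₁ x ⬝ᵥ P₁₁ *ᵥ Z1 d₁ x) ∧
    (∀ x ξ : ℝ, T.2.1.at x ξ =
      Z1 d₁ x ⬝ᵥ P₁₂ *ᵥ Z2 d₂ x ξ + Z2 d₂ ξ x ⬝ᵥ P₁₃ᵀ *ᵥ Z1 d₁ ξ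
      + (∫ η in (0 : ℝ)..ξ, Z2 d₂ η x ⬝ᵥ P₃₃ *ᵥ Z2 d₂ η ξ)
      + (∫ η in ξ..x, Z2 d₂ η x ⬝ᵥ P₂₃ᵀ *ᵥ Z2 d₂ η ξ)
      + (∫ η in x..(1 : ℝ), Z2 d₂ η x ⬝ᵥ P₂₂ *ᵥ Z2 d₂ η ξ)) ∧
    T.2.2 = T.2.1.flip}

/-! ### The map `Ω_s` -/

/-- The polynomial `M̂`. -/
def Mhat (a b c : ℝ[X]) (α ε : ℝ) (M : ℝ[X]) (K₁ K₂ : BiPoly) : ℝ[X] :=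
  Polynomial.derivative (Polynomial.derivative (a * M) - b * M)
    + 2 * (dX (inX a * (K₁ - K₂))).diag
    + 2 * M * c - Polynomial.C (Real.pi ^ 2 / 2 * α * ε)

/-- The polynomial `K̂₁`. -/
def K1hat (a b c : ℝ[X]) (K₁ : BiPoly) : BiPoly :=
  dX (dX (inX a * K₁) - inX b * K₁) + dXi (dXi (inXi a * K₁) - inXi b * K₁)
    + (inX c + inXi c) * K₁

/-- `Ω_s(M, K₁, K₂) = (M̂, K̂₁, K̂₂)`, where `K̂₂(x, ξ) = K̂₁(ξ, x)`. -/
def OmegaS (a b c : ℝ[X]) (α ε : ℝ) (T : ℝ[X] × BiPoly × BiPoly) : ℝ[X] × BiPoly × BiPoly :=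
  (Mhat a b c α ε T.1 T.2.1 T.2.2, K1hat a b c T.2.1, (K1hat a b c T.2.1).flip)

/-! ### The space `L₂(0,1)`, the domain `D₀` and classical solutions -/

/-- `L₂(0,1)`. -/
abbrev L2 := Lp ℝ 2 (volume.restrict (Icc (0 : ℝ) 1))

/-- `y` is (the `C¹` representative of) an element of `H²(0,1)`, with first derivative `y₁` and
second derivative `y₂`: `y` is differentiable on `[0,1]`, its derivative `y₁` is absolutely
continuous, and `y₁' = y₂` almost everywhere with `y₂` square integrable. -/
structure IsH2 (y y₁ y₂ : ℝ → ℝ) : Prop where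
  hasDeriv : ∀ x ∈ Icc (0 : ℝ) 1, HasDerivWithinAt y (y₁ x) (Icc 0 1) x
  absCont : AbsolutelyContinuousOnInterval y₁ 0 1
  hasDeriv₂ : ∀ᵐ x ∂(volume.restrict (Icc (0 : ℝ) 1)), HasDerivAt y₁ (y₂ x) x
  memLp : MemLp y₂ 2 (volume.restrict (Icc (0 : ℝ) 1))

/-- `f ∈ D₀ = {y ∈ H²(0,1) : y(0) = y'(1) = 0}`, where `y` is the `C¹` representative of `f` and
`y₁`, `y₂` are its derivatives. -/
def IsD0Rep (f : L2) (y y₁ y₂ : ℝ → ℝ) : Prop :=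
  IsH2 y y₁ y₂ ∧ (f : ℝ → ℝ) =ᵐ[volume.restrict (Icc (0 : ℝ) 1)] y ∧ y 0 = 0 ∧ y₁ 1 = 0

/-- The domain `D₀`. -/
def D0 : Set L2 := {f | ∃ y y₁ y₂ : ℝ → ℝ, IsD0Rep f y y₁ y₂}

/-- `f ∈ D₀` and `g = a f'' + b f' + c f`. -/
def OpGraph (a b c : ℝ[X]) (f g : L2) : Prop :=
  ∃ y y₁ y₂ : ℝ → ℝ, IsD0Rep f y y₁ y₂ ∧
    (g : ℝ → ℝ) =ᵐ[volume.restrict (Icc (0 : ℝ) 1)]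
      fun x => a.eval x * y₂ x + b.eval x * y₁ x + c.eval x * y x

/-- Classical solutions of `w_t = a w_xx + b w_x + c w`, `w(0,t) = 0`, `w_x(1,t) = 0`: functions
`w` into `L₂(0,1)`, continuous on `[0,∞)` and continuously differentiable on `(0,∞)`, such that
`w(t) ∈ D₀` and the equation holds for all `t > 0`. -/
structure IsClassicalSolution (a b c : ℝ[X]) (w : ℝ → L2) : Prop where
  continuousOn : ContinuousOn w (Ici 0)
  contDiffOn : ContDiffOn ℝ 1 w (Ioi 0)
  equation : ∀ t : ℝ, 0 < t → OpGraph a b c (w t) (deriv w t)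

end

end ParabolicLMI

open ParabolicLMI

/-! The proof uses the Lyapunov functional `V(f) = ⟨f, Pf⟩`, where `P` is multiplication by `M` plus
the integral operator with kernel `K₁` below the diagonal and `K₂` above it. Since `K₂` is the
transpose of `K₁`, `V` comes from a bounded symmetric bilinear form on `L₂(0,1)`. It remains to
prove coercivity, `V(f) ≥ ε‖f‖²`, and dissipation, `V' ≤ -2δV` along solutions.

Coercivity (`Xi.lower_bound`): a triple in the cone is an integral over `η` of quadratic forms. For
each `η` the positive semidefinite matrix is tested on `f(η)Z₁(η)` together with the integrals of
`Z₂(η,·)f` over `[η,1]` and `[0,η]`. The three integrals defining `K₁` record which of these two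
pieces contains `x` and which contains `ξ`.

Dissipation (`dissipation`): integration by parts removes the second derivative of the state. The
boundary conditions on the state and the kernels, together with the sign condition on `M`, make the
boundary contributions vanish or have the right sign. The remaining term `-2∫ aM (w_x)²` is bounded
by Wirtinger's inequality (`wirtinger`), which accounts for the constant in `M̂`. Hence `V'` is at
most the form of `Ω_s(M,K₁,K₂)`, and the second cone condition bounds that form by `-2δV`.

Grönwall (`quadratic_exp_decay`) gives `V(w(t)) ≤ V(w(0))e^{-2δt}`. Coercivity at time `t` and
boundedness of the form at time `0` turn this into the norm estimate. -/

namespace ParabolicLMI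

/-! ### Evaluation and transposition of bivariate polynomials -/

namespace BiPoly

@[simp] lemma at_add (A B : BiPoly) (x ξ : ℝ) : (A + B).at x ξ = A.at x ξ + B.at x ξ := by
  simp [BiPoly.at]

@[simp] lemma at_sub (A B : BiPoly) (x ξ : ℝ) : (A - B).at x ξ = A.at x ξ - B.at x ξ := by
  simp [BiPoly.at]

@[simp] lemma at_mul (A B : BiPoly) (x ξ : ℝ) : (A * B).at x ξ = A.at x ξ * B.at x ξ := by
  simp [BiPoly.at]

@[simp] lemma at_smul (r : ℝ) (A : BiPoly) (x ξ : ℝ) : (r • A).at x ξ = r * A.at x ξ := by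
  simp [BiPoly.at]

@[simp] lemma at_C (r x ξ : ℝ) : BiPoly.at (MvPolynomial.C r) x ξ = r := by
  simp [BiPoly.at]

@[simp] lemma at_zero (x ξ : ℝ) : (0 : BiPoly).at x ξ = 0 := by
  simp [BiPoly.at]

@[simp] lemma at_X_zero (x ξ : ℝ) : BiPoly.at (MvPolynomial.X 0) x ξ = x := by
  simp [BiPoly.at]

@[simp] lemma at_X_one (x ξ : ℝ) : BiPoly.at (MvPolynomial.X 1) x ξ = ξ := by
  simp [BiPoly.at]

@[simp] lemma at_inX (p : ℝ[X]) (x ξ : ℝ) : (inX p).at x ξ = p.eval x := by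
  induction p using Polynomial.induction_on' with
  | add p q hp hq => simpa [inX] using congrArg₂ (· + ·) hp hq
  | monomial n r => simp [inX, BiPoly.at, Polynomial.aeval_monomial]

@[simp] lemma at_flip (A : BiPoly) (x ξ : ℝ) : A.flip.at x ξ = A.at ξ x := by
  unfold BiPoly.at BiPoly.flip
  rw [MvPolynomial.eval_rename]
  congr 2
  ext i
  fin_cases i <;> simp

@[simp] lemma eval_diag (A : BiPoly) (x : ℝ) : A.diag.eval x = A.at x x := by
  induction A using MvPolynomial.induction_on with
  | C r => simp [BiPoly.at, BiPoly.diag]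
  | add p q hp hq => simpa [BiPoly.diag] using congrArg₂ (· + ·) hp hq
  | mul_X p i hp =>
    simp only [BiPoly.diag] at hp
    fin_cases i <;> simp [BiPoly.diag, BiPoly.at, hp]

@[fun_prop] lemma continuous_at_comp {X : Type*} [TopologicalSpace X] (A : BiPoly)
    {u v : X → ℝ} (hu : Continuous u) (hv : Continuous v) :
    Continuous (fun p : X => BiPoly.at A (u p) (v p)) := by
  unfold BiPoly.at
  refine (MvPolynomial.continuous_eval A).comp (continuous_pi fun i => ?_)
  fin_cases i
  · simpa using hu
  · simpa using hv

@[simp] lemma flip_flip (A : BiPoly) : A.flip.flip = A := by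
  have h : (Equiv.swap (0 : Fin 2) 1) ∘ (Equiv.swap (0 : Fin 2) 1) = id := by
    ext i; simp
  simp [BiPoly.flip, MvPolynomial.rename_rename, h]

@[simp] lemma flip_add (A B : BiPoly) : (A + B).flip = A.flip + B.flip := by simp [BiPoly.flip]

@[simp] lemma flip_sub (A B : BiPoly) : (A - B).flip = A.flip - B.flip := by simp [BiPoly.flip]

@[simp] lemma flip_mul (A B : BiPoly) : (A * B).flip = A.flip * B.flip := by simp [BiPoly.flip]

@[simp] lemma flip_inX (p : ℝ[X]) : (inX p).flip = inXi p := by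
  have h := Polynomial.map_aeval_eq_aeval_map (R := ℝ) (S := BiPoly) (T := ℝ) (U := BiPoly)
    (φ := RingHom.id ℝ) (ψ := (MvPolynomial.rename (Equiv.swap (0 : Fin 2) 1)).toRingHom)
    (by ext; simp) p (MvPolynomial.X 0)
  simp [BiPoly.flip, inX, inXi] at h ⊢

@[simp] lemma flip_dX (A : BiPoly) : (dX A).flip = dXi A.flip := by
  have h := MvPolynomial.pderiv_rename (R := ℝ) (Equiv.swap (0 : Fin 2) 1).injective 0 A
  simpa [BiPoly.flip, dX, dXi] using h.symm

@[simp] lemma flip_dXi (A : BiPoly) : (dXi A).flip = dX A.flip := by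
  conv_lhs => rw [← A.flip_flip, ← flip_dX, flip_flip]

end BiPoly

/-! ### Integral operators with a kernel split along the diagonal -/

/-- The operator `f ↦ ∫₀ˣ A(x, ξ) f(ξ) dξ + ∫ₓ¹ B(x, ξ) f(ξ) dξ`. -/
noncomputable def triOp (A B : BiPoly) (f : ℝ → ℝ) (x : ℝ) : ℝ :=
  (∫ ξ in (0 : ℝ)..x, A.at x ξ * f ξ) + ∫ ξ in x..(1 : ℝ), B.at x ξ * f ξ

/-- Leibniz's rule by induction on the kernel: a factor `x` leaves the integral and is handled by
the product rule, while a factor `ξ` is absorbed into `f`. The latter is why `f` is generalized in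
the induction. -/
lemma hasDerivAt_integral_biPoly (A : BiPoly) (c x : ℝ) {f : ℝ → ℝ} (hf : Continuous f) :
    HasDerivAt (fun x => ∫ ξ in c..x, A.at x ξ * f ξ)
      (A.at x x * f x + ∫ ξ in c..x, (dX A).at x ξ * f ξ) x := by
  induction A using MvPolynomial.induction_on generalizing f with
  | C r =>
    have h : Continuous fun ξ => r * f ξ := by fun_prop
    simpa [dX, -intervalIntegral.integral_const_mul] using
      (h.integral_hasStrictDerivAt c x).hasDerivAt
  | add p q hp hq =>
    have e : ∀ (p q : BiPoly) (x : ℝ), (∫ ξ in c..x, (p + q).at x ξ * f ξ)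
        = (∫ ξ in c..x, p.at x ξ * f ξ) + ∫ ξ in c..x, q.at x ξ * f ξ := fun p q x => by
      rw [← intervalIntegral.integral_add]
      · simp [add_mul]
      all_goals exact Continuous.intervalIntegrable (by fun_prop) _ _
    have h := (hp hf).add (hq hf)
    rw [show dX (p + q) = dX p + dX q by simp [dX]]
    simp only [e]
    exact h.congr_deriv (by simp; ring)
  | mul_X p i hp =>
    fin_cases i
    · have h := (hasDerivAt_id x).mul (hp hf)
      have e : ∀ (x : ℝ), (∫ ξ in c..x, BiPoly.at (p * MvPolynomial.X 0) x ξ * f ξ)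
          = x * ∫ ξ in c..x, BiPoly.at p x ξ * f ξ := fun x => by
        rw [← intervalIntegral.integral_const_mul]
        congr 1; ext ξ; simp; ring
      have e' : (∫ ξ in c..x, (dX (p * MvPolynomial.X 0)).at x ξ * f ξ)
          = (x * ∫ ξ in c..x, (dX p).at x ξ * f ξ) + ∫ ξ in c..x, BiPoly.at p x ξ * f ξ := by
        rw [← intervalIntegral.integral_const_mul, ← intervalIntegral.integral_add]
        · congr 1; ext ξ; simp [dX]; ring
        all_goals exact Continuous.intervalIntegrable (by fun_prop) _ _
      simp only [Fin.zero_eta, e, e']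
      exact h.congr_deriv (by simp; ring)
    · have h := hp (f := fun ξ => ξ * f ξ) (by fun_prop)
      have e : ∀ x ξ : ℝ, BiPoly.at (p * MvPolynomial.X 1) x ξ * f ξ
          = BiPoly.at p x ξ * (ξ * f ξ) := fun x ξ => by simp; ring
      have e' : ∀ x ξ : ℝ, (dX (p * MvPolynomial.X 1)).at x ξ * f ξ
          = (dX p).at x ξ * (ξ * f ξ) := fun x ξ => by simp [dX]; ring
      simpa only [Fin.mk_one, e, e'] using h

/-- The moving endpoints contribute the jump `A - B` of the kernel across the diagonal. -/
lemma hasDerivAt_triOp (A B : BiPoly) {f : ℝ → ℝ} (hf : Continuous f) (x : ℝ) :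
    HasDerivAt (triOp A B f) ((A - B).at x x * f x + triOp (dX A) (dX B) f x) x := by
  have h := (hasDerivAt_integral_biPoly A 0 x hf).sub (hasDerivAt_integral_biPoly B 1 x hf)
  have e : ∀ A B : BiPoly, triOp A B f = fun x =>
      (∫ ξ in (0 : ℝ)..x, A.at x ξ * f ξ) - ∫ ξ in (1 : ℝ)..x, B.at x ξ * f ξ := fun A B => by
    funext x
    rw [triOp, intervalIntegral.integral_symm 1 x, sub_eq_add_neg]
  rw [e, e]
  exact h.congr_deriv (by simp; ring)

@[fun_prop] lemma continuous_triOp (A B : BiPoly) {f : ℝ → ℝ} (hf : Continuous f) :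
    Continuous (triOp A B f) :=
  continuous_iff_continuousAt.2 fun x => (hasDerivAt_triOp A B hf x).continuousAt

lemma triOp_add (A B A' B' : BiPoly) {f : ℝ → ℝ} (hf : Continuous f) (x : ℝ) :
    triOp (A + A') (B + B') f x = triOp A B f x + triOp A' B' f x := by
  have e : ∀ (p q : BiPoly) (c d : ℝ), (∫ ξ in c..d, (p + q).at x ξ * f ξ)
      = (∫ ξ in c..d, p.at x ξ * f ξ) + ∫ ξ in c..d, q.at x ξ * f ξ := fun p q c d => by
    rw [← intervalIntegral.integral_add]
    · simp [add_mul]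
    all_goals exact Continuous.intervalIntegrable (by fun_prop) _ _
  simp only [triOp, e]; ring

lemma triOp_inX_mul (p : ℝ[X]) (A B : BiPoly) (f : ℝ → ℝ) (x : ℝ) :
    triOp (inX p * A) (inX p * B) f x = p.eval x * triOp A B f x := by
  simp only [triOp, BiPoly.at_mul, BiPoly.at_inX, mul_assoc, intervalIntegral.integral_const_mul]
  ring

lemma triOp_smul (r : ℝ) (A B : BiPoly) (f : ℝ → ℝ) (x : ℝ) :
    triOp (r • A) (r • B) f x = r * triOp A B f x := by
  simp only [triOp, BiPoly.at_smul, mul_assoc, intervalIntegral.integral_const_mul]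
  ring

lemma triOp_neg (A B : BiPoly) (f : ℝ → ℝ) (x : ℝ) :
    triOp (-A) (-B) f x = -triOp A B f x := by
  simpa using triOp_smul (-1) A B f x

lemma triOp_sub (A B A' B' : BiPoly) {f : ℝ → ℝ} (hf : Continuous f) (x : ℝ) :
    triOp (A - A') (B - B') f x = triOp A B f x - triOp A' B' f x := by
  rw [sub_eq_add_neg, sub_eq_add_neg, triOp_add _ _ _ _ hf, triOp_neg, sub_eq_add_neg]

/-! ### Triangular kernels on the unit square -/

/-- Lebesgue measure on `[0,1]`. -/
noncomputable abbrev vol01 : Measure ℝ := volume.restrict (Icc (0 : ℝ) 1)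

instance : IsProbabilityMeasure vol01 := ⟨by simp⟩

lemma integral_vol01 (f : ℝ → ℝ) : ∫ x, f x ∂vol01 = ∫ x in (0 : ℝ)..1, f x := by
  rw [intervalIntegral.integral_of_le zero_le_one, integral_Icc_eq_integral_Ioc]

lemma ae_mem_vol01 : ∀ᵐ x ∂vol01, x ∈ Icc (0 : ℝ) 1 := ae_restrict_mem measurableSet_Icc

lemma ae_mem_vol01_prod :
    ∀ᵐ p ∂vol01.prod vol01, p.1 ∈ Icc (0 : ℝ) 1 ∧ p.2 ∈ Icc (0 : ℝ) 1 := by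
  filter_upwards [Measure.quasiMeasurePreserving_fst.ae ae_mem_vol01,
    Measure.quasiMeasurePreserving_snd.ae ae_mem_vol01] with p h1 h2 using ⟨h1, h2⟩

lemma integrable_vol01_of_continuous {f : ℝ → ℝ} (hf : Continuous f) : Integrable f vol01 :=
  hf.continuousOn.integrableOn_Icc

/-- The kernel equal to `A` below the diagonal and to `B` above it. -/
noncomputable def triKernel (A B : BiPoly) (x ξ : ℝ) : ℝ :=
  if ξ ≤ x then A.at x ξ else B.at x ξ

lemma measurable_triKernel (A B : BiPoly) :
    Measurable fun p : ℝ × ℝ => triKernel A B p.1 p.2 := by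
  have h : ∀ A : BiPoly, Continuous fun p : ℝ × ℝ => A.at p.1 p.2 := fun A => by fun_prop
  exact Measurable.ite (measurableSet_le measurable_snd measurable_fst)
    (h A).measurable (h B).measurable

lemma exists_bound_triKernel (A B : BiPoly) :
    ∃ C, ∀ x ∈ Icc (0 : ℝ) 1, ∀ ξ ∈ Icc (0 : ℝ) 1, ‖triKernel A B x ξ‖ ≤ C := by
  have h : ∀ A : BiPoly, ∃ C, ∀ p ∈ Icc (0 : ℝ) 1 ×ˢ Icc (0 : ℝ) 1, ‖A.at p.1 p.2‖ ≤ C :=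
    fun A => (isCompact_Icc.prod isCompact_Icc).exists_bound_of_continuousOn (by fun_prop)
  obtain ⟨C, hC⟩ := h A
  obtain ⟨D, hD⟩ := h B
  refine ⟨max C D, fun x hx ξ hξ => ?_⟩
  unfold triKernel
  split_ifs
  · exact (hC (x, ξ) ⟨hx, hξ⟩).trans (le_max_left _ _)
  · exact (hD (x, ξ) ⟨hx, hξ⟩).trans (le_max_right _ _)

lemma ae_bound_triKernel (A B : BiPoly) :
    ∃ C, 0 ≤ C ∧ ∀ᵐ p ∂vol01.prod vol01, ‖triKernel A B p.1 p.2‖ ≤ C := by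
  obtain ⟨C, hC⟩ := exists_bound_triKernel A B
  refine ⟨C, (norm_nonneg _).trans (hC 0 (by simp) 0 (by simp)), ?_⟩
  filter_upwards [ae_mem_vol01_prod] with p hp using hC _ hp.1 _ hp.2

lemma integrable_triKernel_mul (A B : BiPoly) {f g : ℝ → ℝ} (hf : Integrable f vol01)
    (hg : Integrable g vol01) :
    Integrable (fun p : ℝ × ℝ => triKernel A B p.1 p.2 * (f p.1 * g p.2))
      (vol01.prod vol01) := by
  obtain ⟨C, -, hC⟩ := ae_bound_triKernel A B
  exact (hf.mul_prod hg).bdd_mul (measurable_triKernel A B).aestronglyMeasurable hC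

lemma integral_triKernel_mul (A B : BiPoly) {f : ℝ → ℝ} (hf : Continuous f) {x : ℝ}
    (hx : x ∈ Icc (0 : ℝ) 1) :
    ∫ ξ, triKernel A B x ξ * f ξ ∂vol01 = triOp A B f x := by
  have hA : EqOn (fun ξ => A.at x ξ * f ξ) (fun ξ => triKernel A B x ξ * f ξ) (Ioc 0 x) :=
    fun ξ hξ => by simp [triKernel, hξ.2]
  have hB : EqOn (fun ξ => B.at x ξ * f ξ) (fun ξ => triKernel A B x ξ * f ξ) (Ioc x 1) :=
    fun ξ hξ => by simp [triKernel, not_le.2 hξ.1]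
  have hAi : IntervalIntegrable (fun ξ => A.at x ξ * f ξ) volume 0 x :=
    Continuous.intervalIntegrable (by fun_prop) _ _
  have hBi : IntervalIntegrable (fun ξ => B.at x ξ * f ξ) volume x 1 :=
    Continuous.intervalIntegrable (by fun_prop) _ _
  have hAe := (uIoc_of_le hx.1).symm ▸ hA
  have hBe := (uIoc_of_le hx.2).symm ▸ hB
  rw [integral_vol01, triOp, ← intervalIntegral.integral_add_adjacent_intervals
    (hAi.congr hAe) (hBi.congr hBe)]
  congr 1
  · exact (intervalIntegral.integral_congr_ae (.of_forall hAe)).symm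
  · exact (intervalIntegral.integral_congr_ae (.of_forall hBe)).symm

lemma integral_mul_triOp (A B : BiPoly) {f g : ℝ → ℝ} (hg : Integrable g vol01)
    (hf : Continuous f) :
    ∫ p, triKernel A B p.1 p.2 * (g p.1 * f p.2) ∂vol01.prod vol01
      = ∫ x, g x * triOp A B f x ∂vol01 := by
  rw [integral_prod _ (integrable_triKernel_mul A B hg (integrable_vol01_of_continuous hf))]
  refine integral_congr_ae ?_
  filter_upwards [ae_mem_vol01] with x hx
  rw [← integral_triKernel_mul A B hf hx, ← integral_const_mul]
  congr 1; ext ξ; ring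

/-- An operator and its transpose have the same quadratic form, by Fubini. The kernels need only
match off the diagonal, which is a null set. -/
lemma integral_mul_triOp_flip (A B : BiPoly) {f : ℝ → ℝ} (hf : Continuous f) :
    ∫ x, f x * triOp A B f x ∂vol01 = ∫ x, f x * triOp B.flip A.flip f x ∂vol01 := by
  have hfi := integrable_vol01_of_continuous hf
  have h : ∀ A B : BiPoly, ∫ x, f x * triOp A B f x ∂vol01
      = ∫ x, ∫ ξ, triKernel A B x ξ * (f x * f ξ) ∂vol01 ∂vol01 := fun A B => by
    rw [← integral_mul_triOp A B hfi hf, integral_prod _ (integrable_triKernel_mul A B hfi hfi)]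
  rw [h, h, integral_integral_swap (integrable_triKernel_mul A B hfi hfi)]
  congr 1; ext ξ
  refine integral_congr_ae ?_
  have hne : ∀ᵐ x ∂vol01, x ≠ ξ := ae_restrict_of_ae (by simp [ae_iff])
  filter_upwards [hne] with x hx
  rcases lt_or_gt_of_ne hx with hx | hx <;>
    simp [triKernel, hx.le, not_le.2 hx, mul_comm (f x)]

lemma triKernel_flip_symm (A : BiPoly) (x ξ : ℝ) :
    triKernel A A.flip x ξ = triKernel A A.flip ξ x := by
  rcases lt_trichotomy x ξ with h | h | h
  · simp [triKernel, h.le, not_le.2 h]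
  · rw [h]
  · simp [triKernel, h.le, not_le.2 h]

/-! ### The bounded bilinear form on `L₂(0,1)` -/

section BilinearForm

lemma L2.integrable (f : L2) : Integrable f vol01 := (Lp.memLp f).integrable (by norm_num)

lemma L2.integral_abs_le_norm (f : L2) : ∫ x, |f x| ∂vol01 ≤ ‖f‖ := by
  have h1 : ∫ x, |f x| ∂vol01 = (eLpNorm f 1 vol01).toReal := by
    rw [eLpNorm_one_eq_lintegral_enorm, ← integral_norm_eq_lintegral_enorm
      (Lp.aestronglyMeasurable f)]
    rfl
  rw [h1, Lp.norm_def]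
  exact ENNReal.toReal_mono (Lp.eLpNorm_ne_top f)
    (eLpNorm_le_eLpNorm_of_exponent_le (by norm_num) (Lp.aestronglyMeasurable f))

lemma L2.integrable_mul (f g : L2) : Integrable (fun x => f x * g x) vol01 :=
  (Lp.memLp f).integrable_mul (Lp.memLp g)

lemma L2.integral_abs_mul_le (f g : L2) : ∫ x, |f x * g x| ∂vol01 ≤ ‖f‖ * ‖g‖ := by
  have h : ∫ x, |f x * g x| ∂vol01 = inner ℝ (|f|) (|g|) := by
    rw [L2.inner_def]
    refine integral_congr_ae ?_
    filter_upwards [Lp.coeFn_abs f, Lp.coeFn_abs g] with x h1 h2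
    simp [h1, h2, abs_mul, mul_comm]
  rw [h]
  simpa only [norm_abs_eq_norm] using real_inner_le_norm (|f|) (|g|)

lemma L2.norm_sq (f : L2) : ‖f‖ ^ 2 = ∫ x, f x ^ 2 ∂vol01 := by
  rw [← real_inner_self_eq_norm_sq, L2.inner_def]
  simp [pow_two]

lemma exists_bound_eval (m : ℝ[X]) :
    ∃ C, 0 ≤ C ∧ ∀ᵐ x ∂vol01, ‖m.eval x‖ ≤ C := by
  obtain ⟨C, hC⟩ := isCompact_Icc.exists_bound_of_continuousOn
    (s := Icc (0 : ℝ) 1) (f := fun x => m.eval x) (by fun_prop)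
  refine ⟨C, (norm_nonneg _).trans (hC 0 (by simp)), ?_⟩
  filter_upwards [ae_mem_vol01] with x hx using hC x hx

lemma integrable_eval_mul (m : ℝ[X]) {f : ℝ → ℝ} (hf : Integrable f vol01) :
    Integrable (fun x => m.eval x * f x) vol01 := by
  obtain ⟨C, -, hC⟩ := exists_bound_eval m
  exact hf.bdd_mul (by fun_prop) hC

/-- The value at `(f, g)` of the bilinear form on `L₂(0,1)` given by the multiplier `m` and the
kernel that is `A` below the diagonal and `B` above it. -/
noncomputable def triFormVal (m : ℝ[X]) (A B : BiPoly) (f g : ℝ → ℝ) : ℝ :=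
  ∫ x, m.eval x * (f x * g x) ∂vol01
    + ∫ p, triKernel A B p.1 p.2 * (f p.1 * g p.2) ∂vol01.prod vol01

lemma triFormVal_congr (m : ℝ[X]) (A B : BiPoly) {f f' g g' : ℝ → ℝ} (hf : f =ᵐ[vol01] f')
    (hg : g =ᵐ[vol01] g') : triFormVal m A B f g = triFormVal m A B f' g' := by
  unfold triFormVal
  congr 1
  · refine integral_congr_ae ?_
    filter_upwards [hf, hg] with x h1 h2
    rw [h1, h2]
  · refine integral_congr_ae ?_
    filter_upwards [Measure.quasiMeasurePreserving_fst.ae hf,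
      Measure.quasiMeasurePreserving_snd.ae hg] with p h1 h2
    rw [h1, h2]

lemma triFormVal_add_smul_left (m : ℝ[X]) (A B : BiPoly) (r : ℝ) (f f' g : L2) :
    triFormVal m A B (fun x => f x + r * f' x) g
      = triFormVal m A B f g + r * triFormVal m A B f' g := by
  have h1 := integrable_eval_mul m (L2.integrable_mul f g)
  have h2 := integrable_eval_mul m (L2.integrable_mul f' g)
  have h3 := integrable_triKernel_mul A B (L2.integrable f) (L2.integrable g)
  have h4 := integrable_triKernel_mul A B (L2.integrable f') (L2.integrable g)
  have e1 : ∫ x, m.eval x * ((f x + r * f' x) * g x) ∂vol01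
      = ∫ x, m.eval x * (f x * g x) ∂vol01 + r * ∫ x, m.eval x * (f' x * g x) ∂vol01 := by
    rw [← integral_const_mul, ← integral_add h1 (h2.const_mul r)]
    congr 1; ext x; ring
  have e2 : ∫ p, triKernel A B p.1 p.2 * ((f p.1 + r * f' p.1) * g p.2) ∂vol01.prod vol01
      = ∫ p, triKernel A B p.1 p.2 * (f p.1 * g p.2) ∂vol01.prod vol01
        + r * ∫ p, triKernel A B p.1 p.2 * (f' p.1 * g p.2) ∂vol01.prod vol01 := by
    rw [← integral_const_mul, ← integral_add h3 (h4.const_mul r)]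
    congr 1; ext x; ring
  simp only [triFormVal, e1, e2]; ring

lemma triFormVal_add_smul_right (m : ℝ[X]) (A B : BiPoly) (r : ℝ) (f g g' : L2) :
    triFormVal m A B f (fun x => g x + r * g' x)
      = triFormVal m A B f g + r * triFormVal m A B f g' := by
  have h1 := integrable_eval_mul m (L2.integrable_mul f g)
  have h2 := integrable_eval_mul m (L2.integrable_mul f g')
  have h3 := integrable_triKernel_mul A B (L2.integrable f) (L2.integrable g)
  have h4 := integrable_triKernel_mul A B (L2.integrable f) (L2.integrable g')
  have e1 : ∫ x, m.eval x * (f x * (g x + r * g' x)) ∂vol01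
      = ∫ x, m.eval x * (f x * g x) ∂vol01 + r * ∫ x, m.eval x * (f x * g' x) ∂vol01 := by
    rw [← integral_const_mul, ← integral_add h1 (h2.const_mul r)]
    congr 1; ext x; ring
  have e2 : ∫ p, triKernel A B p.1 p.2 * (f p.1 * (g p.2 + r * g' p.2)) ∂vol01.prod vol01
      = ∫ p, triKernel A B p.1 p.2 * (f p.1 * g p.2) ∂vol01.prod vol01
        + r * ∫ p, triKernel A B p.1 p.2 * (f p.1 * g' p.2) ∂vol01.prod vol01 := by
    rw [← integral_const_mul, ← integral_add h3 (h4.const_mul r)]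
    congr 1; ext x; ring
  simp only [triFormVal, e1, e2]; ring

lemma exists_bound_triFormVal (m : ℝ[X]) (A B : BiPoly) :
    ∃ C, 0 ≤ C ∧ ∀ f g : L2, ‖triFormVal m A B f g‖ ≤ C * ‖f‖ * ‖g‖ := by
  obtain ⟨C, hC0, hC⟩ := exists_bound_eval m
  obtain ⟨D, hD0, hD⟩ := ae_bound_triKernel A B
  refine ⟨C + D, by positivity, fun f g => ?_⟩
  have h1 : ‖∫ x, m.eval x * (f x * g x) ∂vol01‖ ≤ C * (‖f‖ * ‖g‖) := by
    refine (norm_integral_le_of_norm_le ((L2.integrable_mul f g).abs.const_mul C) ?_).trans ?_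
    · filter_upwards [hC] with x hx
      rw [norm_mul, ← Real.norm_eq_abs]
      gcongr
    · rw [integral_const_mul]
      gcongr
      exact L2.integral_abs_mul_le f g
  have h2 : ‖∫ p, triKernel A B p.1 p.2 * (f p.1 * g p.2) ∂vol01.prod vol01‖
      ≤ D * (‖f‖ * ‖g‖) := by
    refine (norm_integral_le_of_norm_le
      (((L2.integrable f).abs.mul_prod (L2.integrable g).abs).const_mul D) ?_).trans ?_
    · filter_upwards [hD] with p hp
      rw [norm_mul, norm_mul, ← Real.norm_eq_abs, ← Real.norm_eq_abs]
      gcongr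
    · rw [integral_const_mul, integral_prod_mul (fun x => |f x|) (fun x => |g x|)]
      gcongr
      · exact L2.integral_abs_le_norm f
      · exact L2.integral_abs_le_norm g
  calc _ ≤ _ := norm_add_le _ _
    _ ≤ C * (‖f‖ * ‖g‖) + D * (‖f‖ * ‖g‖) := add_le_add h1 h2
    _ = _ := by ring

/-- Packaging the form as a continuous bilinear map lets the product rule differentiate it along an
`L₂`-valued curve and gives its upper bound through the operator norm. -/
lemma exists_continuousBilinear_triForm (m : ℝ[X]) (A B : BiPoly) :
    ∃ Φ : L2 →L[ℝ] L2 →L[ℝ] ℝ, ∀ f g : L2, Φ f g = triFormVal m A B f g := by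
  obtain ⟨C, -, hC⟩ := exists_bound_triFormVal m A B
  have hadd : ∀ f f' : L2, ∀ r : ℝ, (↑(f + r • f') : ℝ → ℝ) =ᵐ[vol01] fun x => f x + r * f' x := by
    intro f f' r
    filter_upwards [Lp.coeFn_add f (r • f'), Lp.coeFn_smul r f'] with x h1 h2
    rw [h1, Pi.add_apply, h2, Pi.smul_apply, smul_eq_mul]
  have hl : ∀ (r : ℝ) (f f' g : L2), triFormVal m A B ↑(f + r • f') g
      = triFormVal m A B f g + r * triFormVal m A B f' g := fun r f f' g => by
    rw [triFormVal_congr m A B (hadd f f' r) (ae_eq_refl _), triFormVal_add_smul_left]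
  have hr : ∀ (r : ℝ) (f g g' : L2), triFormVal m A B f ↑(g + r • g')
      = triFormVal m A B f g + r * triFormVal m A B f g' := fun r f g g' => by
    rw [triFormVal_congr m A B (ae_eq_refl _) (hadd g g' r), triFormVal_add_smul_right]
  have hl0 : ∀ g : L2, triFormVal m A B ↑(0 : L2) g = 0 := fun g => by
    have := hC 0 g
    rw [norm_zero, mul_zero, zero_mul] at this
    exact norm_le_zero_iff.1 this
  have hr0 : ∀ f : L2, triFormVal m A B f ↑(0 : L2) = 0 := fun f => by
    have := hC f 0
    rw [norm_zero, mul_zero] at this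
    exact norm_le_zero_iff.1 this
  refine ⟨LinearMap.mkContinuous₂ (LinearMap.mk₂ ℝ (fun f g : L2 => triFormVal m A B f g)
    (fun f f' g => by simpa only [one_smul, one_mul] using hl 1 f f' g)
    (fun r f g => by simpa only [zero_add, hl0, smul_eq_mul] using hl r 0 f g)
    (fun f g g' => by simpa only [one_smul, one_mul] using hr 1 f g g')
    (fun r f g => by simpa only [zero_add, hr0, smul_eq_mul] using hr r f 0 g)) C hC,
    fun f g => rfl⟩

lemma triFormVal_symm (m : ℝ[X]) (A : BiPoly) (f g : ℝ → ℝ) :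
    triFormVal m A A.flip f g = triFormVal m A A.flip g f := by
  unfold triFormVal
  congr 1
  · congr 1; ext x; ring
  · rw [← integral_prod_swap]
    congr 1; ext p
    simp only [Prod.fst_swap, Prod.snd_swap]
    rw [triKernel_flip_symm, mul_comm (f p.2)]

/-- Integrability of `g` suffices, so `g` may be the image of a state under the differential
operator, which need not be continuous. -/
lemma triFormVal_continuous_right (m : ℝ[X]) (A B : BiPoly) {f g : ℝ → ℝ}
    (hg : Integrable g vol01) (hf : Continuous f) :
    triFormVal m A B g f
      = ∫ x in (0 : ℝ)..1, g x * (m.eval x * f x + triOp A B f x) := by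
  have hb : ∀ h : ℝ → ℝ, Continuous h → Integrable (fun x => g x * h x) vol01 := fun h hh => by
    obtain ⟨C, hC⟩ := isCompact_Icc.exists_bound_of_continuousOn
      (s := Icc (0 : ℝ) 1) (f := h) hh.continuousOn
    exact hg.mul_bdd hh.aestronglyMeasurable (ae_mem_vol01.mono hC)
  rw [triFormVal, integral_mul_triOp A B hg hf, ← integral_vol01]
  have e := integral_add (hb (fun x => m.eval x * f x) (by fun_prop))
    (hb (triOp A B f) (by fun_prop))
  simp only [mul_add, e]
  congr 2; ext x; ring

end BilinearForm

/-! ### Positivity of the sum-of-squares cone -/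

lemma ae_mem_vol01_prod₃ : ∀ᵐ q ∂vol01.prod (vol01.prod vol01),
    q.1 ∈ Icc (0 : ℝ) 1 ∧ q.2.1 ∈ Icc (0 : ℝ) 1 ∧ q.2.2 ∈ Icc (0 : ℝ) 1 := by
  filter_upwards [Measure.quasiMeasurePreserving_fst.ae ae_mem_vol01,
    Measure.quasiMeasurePreserving_snd.ae ae_mem_vol01_prod] with p h1 h2 using ⟨h1, h2⟩

/-- A quadratic form assembled from a first order kernel `L` and a square kernel `N`, as a
quadratic form with a single kernel. -/
lemma integral_quadratic_kernel {L : ℝ → ℝ → ℝ} {N : ℝ → ℝ → ℝ → ℝ} {f : ℝ → ℝ}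
    (hL : Measurable fun p : ℝ × ℝ => L p.1 p.2)
    (hN : Measurable fun q : ℝ × ℝ × ℝ => N q.1 q.2.1 q.2.2) {CL CN : ℝ}
    (hLb : ∀ η ∈ Icc (0 : ℝ) 1, ∀ x ∈ Icc (0 : ℝ) 1, ‖L η x‖ ≤ CL)
    (hNb : ∀ η ∈ Icc (0 : ℝ) 1, ∀ x ∈ Icc (0 : ℝ) 1, ∀ ξ ∈ Icc (0 : ℝ) 1, ‖N η x ξ‖ ≤ CN)
    (hf : Integrable f vol01) :
    Integrable (fun η => 2 * (f η * ∫ x, L η x * f x ∂vol01)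
        + ∫ p, N η p.1 p.2 * (f p.1 * f p.2) ∂vol01.prod vol01) vol01 ∧
    ∫ η, (2 * (f η * ∫ x, L η x * f x ∂vol01)
        + ∫ p, N η p.1 p.2 * (f p.1 * f p.2) ∂vol01.prod vol01) ∂vol01
      = ∫ x, f x * ∫ ξ, (L x ξ + L ξ x + ∫ η, N η x ξ ∂vol01) * f ξ ∂vol01 ∂vol01 := by
  have hff := hf.mul_prod hf
  have h1 : Integrable (fun p : ℝ × ℝ => L p.1 p.2 * (f p.1 * f p.2)) (vol01.prod vol01) :=
    hff.bdd_mul hL.aestronglyMeasurable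
      (ae_mem_vol01_prod.mono fun p hp => hLb _ hp.1 _ hp.2)
  have h2 : Integrable (fun p : ℝ × ℝ => L p.2 p.1 * (f p.1 * f p.2)) (vol01.prod vol01) :=
    hff.bdd_mul (hL.comp measurable_swap).aestronglyMeasurable
      (ae_mem_vol01_prod.mono fun p hp => hLb _ hp.2 _ hp.1)
  have h3 : Integrable (fun q : ℝ × ℝ × ℝ => N q.1 q.2.1 q.2.2 * (f q.2.1 * f q.2.2))
      (vol01.prod (vol01.prod vol01)) :=
    (hff.comp_snd vol01).bdd_mul hN.aestronglyMeasurable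
      (ae_mem_vol01_prod₃.mono fun p hp => hNb _ hp.1 _ hp.2.1 _ hp.2.2)
  have i1 : Integrable (fun η => f η * ∫ x, L η x * f x ∂vol01) vol01 := by
    refine h1.integral_prod_left.congr (.of_forall fun η => ?_)
    simp only
    rw [← integral_const_mul]
    congr 1; ext x; ring
  have i3 : Integrable (fun p : ℝ × ℝ => (∫ η, N η p.1 p.2 ∂vol01) * (f p.1 * f p.2))
      (vol01.prod vol01) := by
    refine h3.integral_prod_right.congr (.of_forall fun p => ?_)
    simp only
    rw [integral_mul_const]
  refine ⟨(i1.const_mul 2).add h3.integral_prod_left, ?_⟩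
  have e1 : ∫ η, f η * ∫ x, L η x * f x ∂vol01 ∂vol01
      = ∫ p, L p.1 p.2 * (f p.1 * f p.2) ∂vol01.prod vol01 := by
    rw [integral_prod _ h1]
    congr 1; ext η
    rw [← integral_const_mul]
    congr 1; ext x; ring
  -- Exchanging the two variables turns `2L` into the symmetric kernel `L(x,ξ) + L(ξ,x)`.
  have e2 : ∫ p, L p.1 p.2 * (f p.1 * f p.2) ∂vol01.prod vol01
      = ∫ p, L p.2 p.1 * (f p.1 * f p.2) ∂vol01.prod vol01 := by
    rw [← integral_prod_swap]
    congr 1; ext p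
    simp only [Prod.fst_swap, Prod.snd_swap]; ring
  have e3 : ∫ η, ∫ p, N η p.1 p.2 * (f p.1 * f p.2) ∂vol01.prod vol01 ∂vol01
      = ∫ p, (∫ η, N η p.1 p.2 ∂vol01) * (f p.1 * f p.2) ∂vol01.prod vol01 := by
    rw [integral_integral_swap h3]
    congr 1; ext p
    rw [integral_mul_const]
  have h12 : Integrable (fun p : ℝ × ℝ => L p.1 p.2 * (f p.1 * f p.2)
      + L p.2 p.1 * (f p.1 * f p.2)) (vol01.prod vol01) := h1.add h2
  have h123 : Integrable (fun p : ℝ × ℝ => L p.1 p.2 * (f p.1 * f p.2)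
      + L p.2 p.1 * (f p.1 * f p.2) + (∫ η, N η p.1 p.2 ∂vol01) * (f p.1 * f p.2))
      (vol01.prod vol01) := h12.add i3
  have e4 : ∫ x, f x * ∫ ξ, (L x ξ + L ξ x + ∫ η, N η x ξ ∂vol01) * f ξ ∂vol01 ∂vol01
      = ∫ p, (L p.1 p.2 * (f p.1 * f p.2) + L p.2 p.1 * (f p.1 * f p.2)
        + (∫ η, N η p.1 p.2 ∂vol01) * (f p.1 * f p.2)) ∂vol01.prod vol01 := by
    rw [integral_prod _ h123]
    congr 1; ext x
    rw [← integral_const_mul]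
    congr 1; ext ξ; ring
  rw [integral_add (i1.const_mul 2) h3.integral_prod_left, integral_const_mul, e1, e3, e4,
    integral_add h12 i3, integral_add h1 h2, ← e2]
  ring

/-- The monomials in `(η, x)`, placed in the first block for `x ≤ η` and in the second block
for `η < x`. -/
noncomputable def kerVec (d : ℕ) (η x : ℝ) : Mon2 d ⊕ Mon2 d → ℝ :=
  if x ≤ η then Sum.elim (Z2 d η x) 0 else Sum.elim 0 (Z2 d η x)

lemma measurable_kerVec (d : ℕ) (j : Mon2 d ⊕ Mon2 d) :
    Measurable fun p : ℝ × ℝ => kerVec d p.1 p.2 j := by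
  have hZ : ∀ k : Mon2 d, Measurable fun p : ℝ × ℝ => Z2 d p.1 p.2 k := fun k => by
    unfold Z2; fun_prop
  have hs : MeasurableSet {p : ℝ × ℝ | p.2 ≤ p.1} :=
    measurableSet_le measurable_snd measurable_fst
  have e : (fun p : ℝ × ℝ => kerVec d p.1 p.2 j) = fun p => if p.2 ≤ p.1
      then Sum.elim (Z2 d p.1 p.2) 0 j else Sum.elim 0 (Z2 d p.1 p.2) j := by
    funext p; unfold kerVec; split_ifs <;> rfl
  rw [e]
  refine Measurable.ite hs ?_ ?_ <;> cases j <;> simp [hZ]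

lemma abs_kerVec_le_one (d : ℕ) (j : Mon2 d ⊕ Mon2 d) {η x : ℝ} (hη : η ∈ Icc (0 : ℝ) 1)
    (hx : x ∈ Icc (0 : ℝ) 1) : |kerVec d η x j| ≤ 1 := by
  have hZ : ∀ k : Mon2 d, |Z2 d η x k| ≤ 1 := fun k => by
    unfold Z2
    rw [abs_mul, abs_pow, abs_pow, abs_of_nonneg hη.1, abs_of_nonneg hx.1]
    exact mul_le_one₀ (pow_le_one₀ hη.1 hη.2) (pow_nonneg hx.1 _) (pow_le_one₀ hx.1 hx.2)
  unfold kerVec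
  split_ifs <;> cases j <;> simp [hZ]

lemma abs_Z1_le_one (d : ℕ) (i : Fin (d + 1)) {x : ℝ} (hx : x ∈ Icc (0 : ℝ) 1) :
    |Z1 d x i| ≤ 1 := by
  unfold Z1
  rw [abs_pow, abs_of_nonneg hx.1]
  exact pow_le_one₀ hx.1 hx.2

lemma dotProduct_mulVec_eq_sum {m n : Type*} [Fintype m] [Fintype n] (v : m → ℝ)
    (A : Matrix m n ℝ) (w : n → ℝ) : v ⬝ᵥ A *ᵥ w = ∑ i, ∑ j, A i j * (v i * w j) := by
  simp only [dotProduct, Matrix.mulVec, Finset.mul_sum]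
  exact Finset.sum_congr rfl fun i _ => Finset.sum_congr rfl fun j _ => by ring

lemma abs_dotProduct_mulVec_le {m n : Type*} [Fintype m] [Fintype n] (A : Matrix m n ℝ)
    {v : m → ℝ} {w : n → ℝ} (hv : ∀ i, |v i| ≤ 1) (hw : ∀ j, |w j| ≤ 1) :
    ‖v ⬝ᵥ A *ᵥ w‖ ≤ ∑ i, ∑ j, |A i j| := by
  rw [dotProduct_mulVec_eq_sum]
  refine (norm_sum_le _ _).trans (Finset.sum_le_sum fun i _ => (norm_sum_le _ _).trans
    (Finset.sum_le_sum fun j _ => ?_))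
  rw [Real.norm_eq_abs, abs_mul, abs_mul]
  exact mul_le_of_le_one_right (abs_nonneg _) (mul_le_one₀ (hv i) (abs_nonneg _) (hw j))

section Positivity

variable (d₁ d₂ : ℕ) (B : Matrix (Fin (d₁ + 1)) (Mon2 d₂ ⊕ Mon2 d₂) ℝ)
  (D : Matrix (Mon2 d₂ ⊕ Mon2 d₂) (Mon2 d₂ ⊕ Mon2 d₂) ℝ)

lemma measurable_Z1_kerVec :
    Measurable fun p : ℝ × ℝ => Z1 d₁ p.1 ⬝ᵥ B *ᵥ kerVec d₂ p.1 p.2 := by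
  simp only [dotProduct_mulVec_eq_sum]
  have h : ∀ i, Measurable fun p : ℝ × ℝ => Z1 d₁ p.1 i := fun i => by unfold Z1; fun_prop
  exact Finset.measurable_sum _ fun i _ => Finset.measurable_sum _ fun j _ =>
    ((h i).mul (measurable_kerVec d₂ j)).const_mul _

lemma measurable_kerVec_kerVec :
    Measurable fun q : ℝ × ℝ × ℝ => kerVec d₂ q.1 q.2.1 ⬝ᵥ D *ᵥ kerVec d₂ q.1 q.2.2 := by
  simp only [dotProduct_mulVec_eq_sum]
  exact Finset.measurable_sum _ fun i _ => Finset.measurable_sum _ fun j _ =>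
    (((measurable_kerVec d₂ i).comp (measurable_fst.prodMk measurable_snd.fst)).mul
      ((measurable_kerVec d₂ j).comp (measurable_fst.prodMk measurable_snd.snd))).const_mul _

lemma integrable_kerVec_mul (j : Mon2 d₂ ⊕ Mon2 d₂) {f : ℝ → ℝ} (hf : Integrable f vol01)
    {η : ℝ} (hη : η ∈ Icc (0 : ℝ) 1) : Integrable (fun x => kerVec d₂ η x j * f x) vol01 :=
  hf.bdd_mul ((measurable_kerVec d₂ j).comp measurable_prodMk_left).aestronglyMeasurable
    (ae_mem_vol01.mono fun _ hx => abs_kerVec_le_one d₂ j hη hx)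

/-- For fixed `η` the expression is the quadratic form of the block matrix at `(f(η)Z₁(η), ∫
kerVec(η,x)f(x) dx)`, because each integral factors through these moments. -/
lemma quadratic_kerVec_nonneg (A : Matrix (Fin (d₁ + 1)) (Fin (d₁ + 1)) ℝ)
    (h : (Matrix.fromBlocks A B Bᵀ D).PosSemidef) {f : ℝ → ℝ} (hf : Integrable f vol01)
    {η : ℝ} (hη : η ∈ Icc (0 : ℝ) 1) :
    0 ≤ (Z1 d₁ η ⬝ᵥ A *ᵥ Z1 d₁ η) * f η ^ 2
      + (2 * (f η * ∫ x, (Z1 d₁ η ⬝ᵥ B *ᵥ kerVec d₂ η x) * f x ∂vol01)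
      + ∫ p, (kerVec d₂ η p.1 ⬝ᵥ D *ᵥ kerVec d₂ η p.2) * (f p.1 * f p.2) ∂vol01.prod vol01) := by
  set g : Mon2 d₂ ⊕ Mon2 d₂ → ℝ := fun j => ∫ x, kerVec d₂ η x j * f x ∂vol01 with hg
  have hi := fun j => integrable_kerVec_mul d₂ j hf hη
  have e1 : ∫ x, (Z1 d₁ η ⬝ᵥ B *ᵥ kerVec d₂ η x) * f x ∂vol01 = Z1 d₁ η ⬝ᵥ B *ᵥ g := by
    have : ∀ x, (Z1 d₁ η ⬝ᵥ B *ᵥ kerVec d₂ η x) * f x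
        = ∑ i, ∑ j, B i j * Z1 d₁ η i * (kerVec d₂ η x j * f x) := fun x => by
      simp only [dotProduct_mulVec_eq_sum, Finset.sum_mul]
      exact Finset.sum_congr rfl fun i _ => Finset.sum_congr rfl fun j _ => by ring
    simp only [this]
    rw [dotProduct_mulVec_eq_sum]
    rw [integral_finsetSum _ fun i _ => integrable_finsetSum _ fun j _ => (hi j).const_mul _]
    refine Finset.sum_congr rfl fun i _ => ?_
    rw [integral_finsetSum _ fun j _ => (hi j).const_mul _]
    refine Finset.sum_congr rfl fun j _ => ?_
    rw [integral_const_mul]; ring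
  have e2 : ∫ p, (kerVec d₂ η p.1 ⬝ᵥ D *ᵥ kerVec d₂ η p.2) * (f p.1 * f p.2)
      ∂vol01.prod vol01 = g ⬝ᵥ D *ᵥ g := by
    have : ∀ p : ℝ × ℝ, (kerVec d₂ η p.1 ⬝ᵥ D *ᵥ kerVec d₂ η p.2) * (f p.1 * f p.2)
        = ∑ i, ∑ j, D i j * ((kerVec d₂ η p.1 i * f p.1) * (kerVec d₂ η p.2 j * f p.2)) :=
      fun p => by
        simp only [dotProduct_mulVec_eq_sum, Finset.sum_mul]
        exact Finset.sum_congr rfl fun i _ => Finset.sum_congr rfl fun j _ => by ring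
    simp only [this]
    rw [dotProduct_mulVec_eq_sum]
    have hij := fun i j => (hi i).mul_prod (hi j)
    have hs : ∀ i, Integrable (fun p : ℝ × ℝ => ∑ j, D i j *
        ((kerVec d₂ η p.1 i * f p.1) * (kerVec d₂ η p.2 j * f p.2))) (vol01.prod vol01) :=
      fun i => integrable_finsetSum _ fun j _ => (hij i j).const_mul _
    rw [integral_finsetSum _ fun i _ => hs i]
    refine Finset.sum_congr rfl fun i _ => ?_
    rw [integral_finsetSum _ fun j _ => (hij i j).const_mul _]
    refine Finset.sum_congr rfl fun j _ => ?_
    rw [integral_const_mul, integral_prod_mul (fun x => kerVec d₂ η x i * f x)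
      (fun x => kerVec d₂ η x j * f x)]
  have key := h.dotProduct_mulVec_nonneg (Sum.elim (f η • Z1 d₁ η) g)
  -- The two off-diagonal blocks contribute equally, which produces the factor `2`.
  have et : g ⬝ᵥ Bᵀ *ᵥ Z1 d₁ η = Z1 d₁ η ⬝ᵥ B *ᵥ g := by
    rw [Matrix.mulVec_transpose, Matrix.dotProduct_mulVec, dotProduct_comm]
  rw [e1, e2]
  simp only [star_trivial, Matrix.fromBlocks_mulVec, Function.comp_def, Sum.elim_inl,
    Sum.elim_inr, sumElim_dotProduct_sumElim, Matrix.mulVec_smul, dotProduct_add,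
    smul_dotProduct, dotProduct_smul, smul_eq_mul, et] at key
  refine key.trans_eq ?_
  ring

lemma form_kerVec_nonneg (A : Matrix (Fin (d₁ + 1)) (Fin (d₁ + 1)) ℝ)
    (h : (Matrix.fromBlocks A B Bᵀ D).PosSemidef) {f : ℝ → ℝ} (hf : Continuous f) :
    0 ≤ ∫ x, (Z1 d₁ x ⬝ᵥ A *ᵥ Z1 d₁ x) * f x ^ 2 ∂vol01
      + ∫ x, f x * ∫ ξ, (Z1 d₁ x ⬝ᵥ B *ᵥ kerVec d₂ x ξ + Z1 d₁ ξ ⬝ᵥ B *ᵥ kerVec d₂ ξ x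
        + ∫ η, kerVec d₂ η x ⬝ᵥ D *ᵥ kerVec d₂ η ξ ∂vol01) * f ξ ∂vol01 ∂vol01 := by
  have hfi := integrable_vol01_of_continuous hf
  obtain ⟨hi, he⟩ := integral_quadratic_kernel (measurable_Z1_kerVec d₁ d₂ B)
    (measurable_kerVec_kerVec d₂ D)
    (fun η hη x hx => abs_dotProduct_mulVec_le B (fun i => abs_Z1_le_one d₁ i hη)
      (fun j => abs_kerVec_le_one d₂ j hη hx))
    (fun η hη x hx ξ hξ => abs_dotProduct_mulVec_le D (fun i => abs_kerVec_le_one d₂ i hη hx)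
      (fun j => abs_kerVec_le_one d₂ j hη hξ)) hfi
  have hA : Integrable (fun x => (Z1 d₁ x ⬝ᵥ A *ᵥ Z1 d₁ x) * f x ^ 2) vol01 := by
    refine integrable_vol01_of_continuous ?_
    simp only [dotProduct_mulVec_eq_sum, Z1]
    fun_prop
  rw [← he, ← integral_add hA hi]
  refine integral_nonneg_of_ae ?_
  filter_upwards [ae_mem_vol01] with η hη
    using quadratic_kerVec_nonneg d₁ d₂ B D A h hfi hη

end Positivity

/-- With `ξ < x`, both vectors lie in the second block for `η < ξ`, only the one at `x` does for `ξ
< η < x`, and neither does for `η > x`. This selects `P₃₃`, `P₂₃ᵀ` and `P₂₂` respectively. -/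
lemma integral_kerVec_of_lt {d : ℕ} (P₂₂ P₂₃ P₃₃ : Matrix (Mon2 d) (Mon2 d) ℝ) {x ξ : ℝ}
    (hx : x ∈ Icc (0 : ℝ) 1) (hξ : ξ ∈ Icc (0 : ℝ) 1) (hlt : ξ < x) :
    ∫ η, kerVec d η x ⬝ᵥ Matrix.fromBlocks P₂₂ P₂₃ P₂₃ᵀ P₃₃ *ᵥ kerVec d η ξ ∂vol01
      = (∫ η in (0 : ℝ)..ξ, Z2 d η x ⬝ᵥ P₃₃ *ᵥ Z2 d η ξ)
      + (∫ η in ξ..x, Z2 d η x ⬝ᵥ P₂₃ᵀ *ᵥ Z2 d η ξ)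
      + (∫ η in x..(1 : ℝ), Z2 d η x ⬝ᵥ P₂₂ *ᵥ Z2 d η ξ) := by
  set D := Matrix.fromBlocks P₂₂ P₂₃ P₂₃ᵀ P₃₃ with hD
  have hi : IntegrableOn (fun η => kerVec d η x ⬝ᵥ D *ᵥ kerVec d η ξ) (Icc 0 1) volume := by
    refine Integrable.of_bound (C := ∑ i, ∑ j, |D i j|) ?_ ?_
    · exact ((measurable_kerVec_kerVec d D).comp
        (measurable_id.prodMk (measurable_const (a := (x, ξ))))).aestronglyMeasurable
    · filter_upwards [ae_mem_vol01] with η hη using abs_dotProduct_mulVec_le D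
        (fun i => abs_kerVec_le_one d i hη hx) (fun j => abs_kerVec_le_one d j hη hξ)
  have hii : ∀ u ∈ Icc (0 : ℝ) 1, ∀ v ∈ Icc (0 : ℝ) 1, IntervalIntegrable
      (fun η => kerVec d η x ⬝ᵥ D *ᵥ kerVec d η ξ) volume u v := fun u hu v hv =>
    (hi.mono_set (uIcc_subset_Icc hu hv)).intervalIntegrable
  have h0 : (0 : ℝ) ∈ Icc (0 : ℝ) 1 := by simp
  have h1 : (1 : ℝ) ∈ Icc (0 : ℝ) 1 := by simp
  rw [integral_vol01, ← intervalIntegral.integral_add_adjacent_intervals (hii 0 h0 x hx)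
    (hii x hx 1 h1), ← intervalIntegral.integral_add_adjacent_intervals (hii 0 h0 ξ hξ)
    (hii ξ hξ x hx)]
  have hne : ∀ u : ℝ, ∀ᵐ η : ℝ, η ≠ u := fun u => by simp [ae_iff]
  have hsum : ∀ v w v' w' : Mon2 d → ℝ, Sum.elim v w ⬝ᵥ D *ᵥ Sum.elim v' w'
      = v ⬝ᵥ P₂₂ *ᵥ v' + v ⬝ᵥ P₂₃ *ᵥ w' + (w ⬝ᵥ P₂₃ᵀ *ᵥ v' + w ⬝ᵥ P₃₃ *ᵥ w') := by
    intro v w v' w'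
    simp [hD, Matrix.fromBlocks_mulVec, sumElim_dotProduct_sumElim,
      dotProduct_add]
  congr 1
  · congr 1 <;> refine intervalIntegral.integral_congr_ae ?_
    · filter_upwards [hne ξ] with η hη hm
      rw [uIoc_of_le hξ.1] at hm
      have : η < ξ := lt_of_le_of_ne hm.2 hη
      simp [kerVec, not_le.2 this, not_le.2 (this.trans hlt), hsum]
    · filter_upwards [hne x] with η hη hm
      rw [uIoc_of_le hlt.le] at hm
      have : η < x := lt_of_le_of_ne hm.2 hη
      simp [kerVec, not_le.2 this, hm.1.le, hsum]
  · refine intervalIntegral.integral_congr_ae (.of_forall fun η hm => ?_)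
    rw [uIoc_of_le hx.2] at hm
    simp [kerVec, hm.1.le, (hlt.trans hm.1).le, hsum]

/-- The integrated matrix form has a symmetric kernel that equals `K₁` below the diagonal. Symmetry
and `K₂ = K₁.flip` identify it above, and the diagonal itself is negligible. -/
lemma Xi.lower_bound {d₁ d₂ : ℕ} {ε : ℝ} {M : ℝ[X]} {K₁ K₂ : BiPoly}
    (h : (M, K₁, K₂) ∈ Xi d₁ d₂ ε) {f : ℝ → ℝ} (hf : Continuous f) :
    ε * ∫ x in (0 : ℝ)..1, f x ^ 2 ≤
      ∫ x in (0 : ℝ)..1, f x * (M.eval x * f x + triOp K₁ K₂ f x) := by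
  obtain ⟨P₁₁, P₁₂, P₁₃, P₂₂, P₂₃, P₃₃, hP, hM, hK₁, hK₂⟩ := h
  simp only at hM hK₁ hK₂
  set D := Matrix.fromBlocks P₂₂ P₂₃ P₂₃ᵀ P₃₃ with hD
  set B := Matrix.fromCols P₁₂ P₁₃ with hB
  rw [← Matrix.transpose_fromCols] at hP
  have hDsymm : Dᵀ = D := by
    have := hP.isHermitian
    rw [Matrix.isHermitian_fromBlocks_iff] at this
    simpa [Matrix.IsHermitian] using this.2.2.2
  have key := form_kerVec_nonneg d₁ d₂ B D _ hP hf
  -- The first entry of `Z1` is `1`, so subtracting `ε` in the corner lowers the multiplier by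
  -- exactly `ε`.
  have hMe : ∀ x, Z1 d₁ x ⬝ᵥ (P₁₁ - Matrix.single 0 0 ε) *ᵥ Z1 d₁ x = M.eval x - ε := fun x => by
    rw [Matrix.sub_mulVec, dotProduct_sub, hM]
    rw [dotProduct_mulVec_eq_sum (Z1 d₁ x) (Matrix.single (0 : Fin (d₁ + 1)) 0 ε)]
    simp [Matrix.single_apply, ite_and, Z1]
  set H : ℝ → ℝ → ℝ := fun x ξ => Z1 d₁ x ⬝ᵥ B *ᵥ kerVec d₂ x ξ
    + Z1 d₁ ξ ⬝ᵥ B *ᵥ kerVec d₂ ξ x + ∫ η, kerVec d₂ η x ⬝ᵥ D *ᵥ kerVec d₂ η ξ ∂vol01 with hH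
  have hHsymm : ∀ x ξ, H x ξ = H ξ x := fun x ξ => by
    have : ∀ η, kerVec d₂ η x ⬝ᵥ D *ᵥ kerVec d₂ η ξ = kerVec d₂ η ξ ⬝ᵥ D *ᵥ kerVec d₂ η x :=
      fun η => by
        rw [Matrix.dotProduct_mulVec, dotProduct_comm, ← Matrix.mulVec_transpose, hDsymm]
    simp only [hH, this]; ring
  have hHlt : ∀ x ∈ Icc (0 : ℝ) 1, ∀ ξ ∈ Icc (0 : ℝ) 1, ξ < x → H x ξ = K₁.at x ξ := by
    intro x hx ξ hξ hlt
    have e1 : Z1 d₁ x ⬝ᵥ B *ᵥ kerVec d₂ x ξ = Z1 d₁ x ⬝ᵥ P₁₂ *ᵥ Z2 d₂ x ξ := by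
      simp [kerVec, hlt.le, hB, Matrix.fromCols_mulVec]
    have e2 : Z1 d₁ ξ ⬝ᵥ B *ᵥ kerVec d₂ ξ x = Z2 d₂ ξ x ⬝ᵥ P₁₃ᵀ *ᵥ Z1 d₁ ξ := by
      rw [Matrix.mulVec_transpose, dotProduct_comm (Z2 d₂ ξ x), ← Matrix.dotProduct_mulVec]
      simp [kerVec, not_le.2 hlt, hB, Matrix.fromCols_mulVec]
    simp only [hH, e1, e2]
    rw [integral_kerVec_of_lt P₂₂ P₂₃ P₃₃ hx hξ hlt, hK₁]
    ring
  have e : ∫ x, f x * ∫ ξ, H x ξ * f ξ ∂vol01 ∂vol01 = ∫ x, f x * triOp K₁ K₂ f x ∂vol01 := by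
    refine integral_congr_ae ?_
    filter_upwards [ae_mem_vol01] with x hx
    rw [← integral_triKernel_mul K₁ K₂ hf hx]
    congr 1
    refine integral_congr_ae ?_
    have hne : ∀ᵐ ξ ∂vol01, ξ ≠ x := ae_restrict_of_ae (by simp [ae_iff])
    filter_upwards [hne, ae_mem_vol01] with ξ hξ hm
    congr 1
    rcases lt_or_gt_of_ne hξ with hlt | hlt
    · rw [hHlt x hx ξ hm hlt, triKernel, if_pos hlt.le]
    · rw [hHsymm, hHlt ξ hm x hx hlt, triKernel, if_neg (not_le.2 hlt), hK₂, BiPoly.at_flip]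
  rw [e, integral_vol01, integral_vol01, ← intervalIntegral.integral_add] at key
  · rw [← intervalIntegral.integral_const_mul, ← sub_nonneg, ← intervalIntegral.integral_sub]
    · convert key using 3 with x
      rw [hMe]; ring
    all_goals exact Continuous.intervalIntegrable (by fun_prop) _ _
  · simp only [hMe]
    exact Continuous.intervalIntegrable (by fun_prop) _ _
  · exact Continuous.intervalIntegrable (by fun_prop) _ _

/-! ### Wirtinger's inequality -/

/-- The function `q(x) = ω tan(ω(1-x))` solves the Riccati equation `q' = -ω² - q²`, whence `y₁² -
ω²y² = (qy²)' + (y₁ - qy)²`. The total derivative integrates to zero, as `q(1) = 0` and `y(0) = 0`.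
The strict bound `ω < π/2` keeps `q` free of poles on `[0,1]`; the sharp constant is then a limit.
-/
lemma integral_sq_mul_le_of_lt {y y₁ : ℝ → ℝ} (hy : ∀ x, HasDerivAt y (y₁ x) x)
    (hy₁ : Continuous y₁) (h0 : y 0 = 0) {ω : ℝ} (hω0 : 0 < ω) (hω : ω < Real.pi / 2) :
    ω ^ 2 * ∫ x in (0 : ℝ)..1, y x ^ 2 ≤ ∫ x in (0 : ℝ)..1, y₁ x ^ 2 := by
  have hyc : Continuous y := continuous_iff_continuousAt.2 fun x => (hy x).continuousAt
  have hcos : ∀ x ∈ Icc (0 : ℝ) 1, 0 < Real.cos (ω * (1 - x)) := fun x hx =>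
    Real.cos_pos_of_mem_Ioo ⟨by nlinarith [hx.1, hx.2, Real.pi_pos], by nlinarith [hx.1, hx.2]⟩
  set q : ℝ → ℝ := fun x => ω * Real.tan (ω * (1 - x)) with hq
  have hqd : ∀ x ∈ Icc (0 : ℝ) 1, HasDerivAt q (-ω ^ 2 - q x ^ 2) x := fun x hx => by
    have hc := (hcos x hx).ne'
    have hl : HasDerivAt (fun x => ω * (1 - x)) (-ω) x := by
      simpa using ((hasDerivAt_id x).const_sub 1).const_mul ω
    have ht := ((Real.hasDerivAt_tan hc).comp x hl).const_mul ω
    refine ht.congr_deriv ?_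
    simp only [hq, Real.tan_eq_sin_div_cos]
    have := Real.sin_sq_add_cos_sq (ω * (1 - x))
    field_simp
    linear_combination this
  have hqc : ContinuousOn q (Icc 0 1) := fun x hx => (hqd x hx).continuousAt.continuousWithinAt
  have hd : ∀ x ∈ uIcc (0 : ℝ) 1, HasDerivAt (fun x => q x * y x ^ 2)
      (y₁ x ^ 2 - ω ^ 2 * y x ^ 2 - (y₁ x - q x * y x) ^ 2) x := fun x hx => by
    rw [uIcc_of_le zero_le_one] at hx
    refine ((hqd x hx).mul ((hy x).pow 2)).congr_deriv ?_
    simp; ring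
  have hsq : ContinuousOn (fun x => (y₁ x - q x * y x) ^ 2) (uIcc 0 1) := by
    rw [uIcc_of_le zero_le_one]
    fun_prop
  have hi1 : IntervalIntegrable (fun x => y₁ x ^ 2) volume 0 1 :=
    Continuous.intervalIntegrable (by fun_prop) _ _
  have hi2 : IntervalIntegrable (fun x => ω ^ 2 * y x ^ 2) volume 0 1 :=
    Continuous.intervalIntegrable (by fun_prop) _ _
  have hftc := intervalIntegral.integral_eq_sub_of_hasDerivAt hd
    ((hi1.sub hi2).sub hsq.intervalIntegrable)
  rw [intervalIntegral.integral_sub (hi1.sub hi2) hsq.intervalIntegrable,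
    intervalIntegral.integral_sub hi1 hi2, intervalIntegral.integral_const_mul] at hftc
  have hnn : 0 ≤ ∫ x in (0 : ℝ)..1, (y₁ x - q x * y x) ^ 2 :=
    intervalIntegral.integral_nonneg zero_le_one fun x _ => sq_nonneg _
  simp [hq, h0] at hftc
  linarith

/-- Wirtinger's inequality for functions that vanish at the left end point. -/
lemma wirtinger {y y₁ : ℝ → ℝ} (hy : ∀ x, HasDerivAt y (y₁ x) x)
    (hy₁ : Continuous y₁) (h0 : y 0 = 0) :
    (Real.pi / 2) ^ 2 * ∫ x in (0 : ℝ)..1, y x ^ 2 ≤ ∫ x in (0 : ℝ)..1, y₁ x ^ 2 := by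
  have hlim : Filter.Tendsto (fun ω : ℝ => ω ^ 2 * ∫ x in (0 : ℝ)..1, y x ^ 2)
      (nhdsWithin (Real.pi / 2) (Iio (Real.pi / 2)))
      (nhds ((Real.pi / 2) ^ 2 * ∫ x in (0 : ℝ)..1, y x ^ 2)) := by
    have : Continuous fun ω : ℝ => ω ^ 2 * ∫ x in (0 : ℝ)..1, y x ^ 2 := by fun_prop
    exact (this.tendsto _).mono_left nhdsWithin_le_nhds
  refine le_of_tendsto hlim ?_
  filter_upwards [Ioo_mem_nhdsLT (show (0 : ℝ) < Real.pi / 2 by positivity)] with ω hω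
    using integral_sq_mul_le_of_lt hy hy₁ h0 hω.1 hω.2

/-! ### Representatives of `H²` functions and integration by parts -/

/-- A function in `H²(0,1)` that vanishes at `0` extends to a continuously differentiable function
on the line, and its second derivative can be integrated by parts. -/
lemma IsH2.exists_extension {y y₁ y₂ : ℝ → ℝ} (h : IsH2 y y₁ y₂) (h0 : y 0 = 0) :
    ∃ Y Y₁ : ℝ → ℝ, (∀ x, HasDerivAt Y (Y₁ x) x) ∧ Continuous Y₁ ∧
      EqOn Y y (Icc 0 1) ∧ EqOn Y₁ y₁ (Icc 0 1) ∧ Integrable y₂ vol01 ∧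
      ∀ g g₁ : ℝ → ℝ, (∀ x, HasDerivAt g (g₁ x) x) → Continuous g₁ →
        ∫ x in (0 : ℝ)..1, y₂ x * g x
          = Y₁ 1 * g 1 - Y₁ 0 * g 0 - ∫ x in (0 : ℝ)..1, Y₁ x * g₁ x := by
  have hy₁c : ContinuousOn y₁ (Icc 0 1) := by
    simpa [uIcc_of_le (zero_le_one : (0 : ℝ) ≤ 1)] using h.absCont.continuousOn
  -- The derivative is continued by its endpoint values, and the function is recovered as its
  -- primitive; starting it at `0` agrees with `y 0 = 0`.
  set Y₁ : ℝ → ℝ := IccExtend zero_le_one (domRestrict (Icc 0 1) y₁) with hY₁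
  have hY₁c : Continuous Y₁ := (continuousOn_iff_continuous_domRestrict.1 hy₁c).Icc_extend'
  have hY₁e : EqOn Y₁ y₁ (Icc 0 1) := fun x hx => by
    simp [hY₁, IccExtend_of_mem _ _ hx]
  set Y : ℝ → ℝ := fun x => ∫ t in (0 : ℝ)..x, Y₁ t with hY
  have hYd : ∀ x, HasDerivAt Y (Y₁ x) x := fun x =>
    (hY₁c.integral_hasStrictDerivAt 0 x).hasDerivAt
  have hYe : EqOn Y y (Icc 0 1) := fun x hx => by
    have hc : ContinuousOn y (Icc 0 x) := fun t ht =>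
      ((h.hasDeriv t ⟨ht.1, ht.2.trans hx.2⟩).continuousWithinAt).mono
        (Icc_subset_Icc_right hx.2)
    have := intervalIntegral.integral_eq_sub_of_hasDerivAt_of_le hx.1 hc (f' := Y₁)
      (fun t ht => by
        have ht' : t ∈ Icc (0 : ℝ) 1 := ⟨ht.1.le, ht.2.le.trans hx.2⟩
        rw [hY₁e ht']
        exact (h.hasDeriv t ht').hasDerivAt (Icc_mem_nhds ht.1 (ht.2.trans_le hx.2)))
      (hY₁c.intervalIntegrable _ _)
    simp [hY, this, h0]
  refine ⟨Y, Y₁, hYd, hY₁c, hYe, hY₁e, h.memLp.integrable (by norm_num), fun g g₁ hg hg₁ => ?_⟩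
  have hgc : ContDiff ℝ 1 g := by
    rw [contDiff_one_iff_deriv]
    refine ⟨fun x => (hg x).differentiableAt, ?_⟩
    rwa [show deriv g = g₁ from funext fun x => (hg x).deriv]
  have hac : AbsolutelyContinuousOnInterval g 0 1 :=
    hgc.contDiffOn.absolutelyContinuousOnInterval
  have hibp := hac.integral_mul_deriv_eq_deriv_mul h.absCont
  have e1 : ∫ x in (0 : ℝ)..1, g x * deriv y₁ x = ∫ x in (0 : ℝ)..1, y₂ x * g x := by
    rw [← integral_vol01, ← integral_vol01]
    refine integral_congr_ae ?_
    filter_upwards [h.hasDeriv₂] with x hx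
    rw [hx.deriv, mul_comm]
  have e2 : ∫ x in (0 : ℝ)..1, deriv g x * y₁ x = ∫ x in (0 : ℝ)..1, Y₁ x * g₁ x := by
    rw [← integral_vol01, ← integral_vol01]
    refine integral_congr_ae ?_
    filter_upwards [ae_mem_vol01] with x hx
    rw [(hg x).deriv, hY₁e hx, mul_comm]
  rw [e1, e2] at hibp
  rw [hibp, hY₁e (by simp : (1 : ℝ) ∈ Icc (0 : ℝ) 1), hY₁e (by simp : (0 : ℝ) ∈ Icc (0 : ℝ) 1)]
  ring

/-! ### The dissipation inequality -/

/-- Testing the matrix on `(Z₁(x), 0)` isolates the corner block. The resulting pointwise bound is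
what allows `Y₁²` to be weighted by `aM` in Wirtinger's inequality. -/
lemma Xi.le_eval {d₁ d₂ : ℕ} {ε : ℝ} {M : ℝ[X]} {K₁ K₂ : BiPoly}
    (h : (M, K₁, K₂) ∈ Xi d₁ d₂ ε) (x : ℝ) : ε ≤ M.eval x := by
  obtain ⟨P₁₁, P₁₂, P₁₃, P₂₂, P₂₃, P₃₃, hP, hM, -, -⟩ := h
  simp only at hM
  have key := hP.dotProduct_mulVec_nonneg (Sum.elim (Z1 d₁ x) 0)
  simp only [star_trivial, Matrix.fromBlocks_mulVec, Sum.elim_comp_inl, Sum.elim_comp_inr,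
    Matrix.mulVec_zero, add_zero, sumElim_dotProduct_sumElim, zero_dotProduct, Matrix.sub_mulVec,
    dotProduct_sub, ← hM, sub_nonneg] at key
  rw [dotProduct_mulVec_eq_sum (Z1 d₁ x) (Matrix.single (0 : Fin (d₁ + 1)) 0 ε)] at key
  simpa [Matrix.single_apply, ite_and, Z1] using key

@[simp] lemma dX_inX (p : ℝ[X]) : dX (inX p) = inX (Polynomial.derivative p) := by
  induction p using Polynomial.induction_on' with
  | add p q hp hq =>
    simp only [inX, dX] at hp hq
    simp [inX, dX, hp, hq]
  | monomial n r =>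
    simp [inX, dX, Polynomial.aeval_monomial, Polynomial.derivative_monomial,
      MvPolynomial.algebraMap_eq]
    ring

lemma dX_sub (A B : BiPoly) : dX (A - B) = dX A - dX B := by simp [dX]

lemma dX_mul (A B : BiPoly) : dX (A * B) = dX A * B + A * dX B := by
  simp only [dX, MvPolynomial.pderiv_mul]

/-- This reduces the final comparison to a pointwise identity: `u` and `v` are total derivatives,
`s` and `t` have equal integrals by transposition, and `p`, `q` are the two sides of Wirtinger's
inequality. -/
lemma integral_linear_combination {R L u v s t p q : ℝ → ℝ} (κ : ℝ) (hL : Continuous L)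
    (hu : Continuous u) (hv : Continuous v) (hs : Continuous s) (ht : Continuous t)
    (hp : Continuous p) (hq : Continuous q)
    (h : ∀ x, R x = L x - u x - 2 * v x + t x - s x + 2 * p x - κ * q x) (a b : ℝ) :
    ∫ x in a..b, R x = (∫ x in a..b, L x) - (∫ x in a..b, u x) - 2 * (∫ x in a..b, v x)
      + (∫ x in a..b, t x) - (∫ x in a..b, s x) + 2 * (∫ x in a..b, p x)
      - κ * ∫ x in a..b, q x := by
  simp only [h]
  rw [intervalIntegral.integral_sub, intervalIntegral.integral_add, intervalIntegral.integral_sub,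
    intervalIntegral.integral_add, intervalIntegral.integral_sub, intervalIntegral.integral_sub,
    intervalIntegral.integral_const_mul, intervalIntegral.integral_const_mul,
    intervalIntegral.integral_const_mul]
  all_goals exact Continuous.intervalIntegrable (by fun_prop) _ _

section Dissipation

variable {a b c M : ℝ[X]} {K₁ : BiPoly} {α ε : ℝ} {Y Y₁ y₂ : ℝ → ℝ}

/-- The multiplier part of the boundary terms: `∫ ((bM - (aM)') Y²)' ≤ 0`. -/
lemma integral_multiplier_boundary_nonpos (hY : ∀ x, HasDerivAt Y (Y₁ x) x)
    (hY₁ : Continuous Y₁) (h0 : Y 0 = 0)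
    (hM : (b.eval 1 - (Polynomial.derivative a).eval 1) * M.eval 1
        - a.eval 1 * (Polynomial.derivative M).eval 1 ≤ 0) :
    ∫ x in (0 : ℝ)..1, ((Polynomial.derivative (b * M - Polynomial.derivative (a * M))).eval x
        * Y x ^ 2
      + (b * M - Polynomial.derivative (a * M)).eval x * (2 * Y x * Y₁ x)) ≤ 0 := by
  have hYc : Continuous Y := continuous_iff_continuousAt.2 fun x => (hY x).continuousAt
  set r := b * M - Polynomial.derivative (a * M) with hr
  have hd : ∀ x ∈ uIcc (0 : ℝ) 1, HasDerivAt (fun x => r.eval x * Y x ^ 2)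
      ((Polynomial.derivative r).eval x * Y x ^ 2 + r.eval x * (2 * Y x * Y₁ x)) x :=
    fun x _ => ((r.hasDerivAt x).mul ((hY x).pow 2)).congr_deriv (by simp)
  rw [intervalIntegral.integral_eq_sub_of_hasDerivAt hd
    (Continuous.intervalIntegrable (by fun_prop) _ _), h0]
  have : r.eval 1 ≤ 0 := by
    simp only [hr, Polynomial.derivative_mul, Polynomial.eval_sub, Polynomial.eval_mul,
      Polynomial.eval_add]
    linarith
  nlinarith [sq_nonneg (Y 1)]

/-- A kernel and its transpose agree on the diagonal, so no jump term appears. The derivative is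
therefore continuous, as integration by parts requires. -/
lemma triOp_flip_deriv_diag (p : ℝ[X]) (hY : Continuous Y) (x : ℝ) :
    HasDerivAt (triOp (inX p * K₁) (inX p * K₁.flip) Y)
      (triOp (dX (inX p * K₁)) (dX (inX p * K₁.flip)) Y x) x :=
  (hasDerivAt_triOp _ _ hY x).congr_deriv (by simp)

/-- The kernel part of the boundary terms vanishes. -/
lemma integral_kernel_boundary (hY : ∀ x, HasDerivAt Y (Y₁ x) x)
    (hY₁ : Continuous Y₁) (h0 : Y 0 = 0)
    (hK₁ : ∀ x ∈ Icc (0 : ℝ) 1,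
      (b.eval 1 - (Polynomial.derivative a).eval 1) * K₁.at 1 x
        - a.eval 1 * (dX K₁).at 1 x = 0) :
    ∫ x in (0 : ℝ)..1, (Y₁ x * (b.eval x * triOp K₁ K₁.flip Y x
          - triOp (dX (inX a * K₁)) (dX (inX a * K₁.flip)) Y x)
        - Y x * ((dX (inX a * (K₁ - K₁.flip))).diag.eval x * Y x
          + triOp (dX (dX (inX a * K₁) - inX b * K₁))
            (dX (dX (inX a * K₁.flip) - inX b * K₁.flip)) Y x)) = 0 := by
  have hYc : Continuous Y := continuous_iff_continuousAt.2 fun x => (hY x).continuousAt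
  have hd : ∀ x ∈ uIcc (0 : ℝ) 1, HasDerivAt (fun x => -(Y x *
      triOp (dX (inX a * K₁) - inX b * K₁) (dX (inX a * K₁.flip) - inX b * K₁.flip) Y x))
      (Y₁ x * (b.eval x * triOp K₁ K₁.flip Y x
          - triOp (dX (inX a * K₁)) (dX (inX a * K₁.flip)) Y x)
        - Y x * ((dX (inX a * (K₁ - K₁.flip))).diag.eval x * Y x
          + triOp (dX (dX (inX a * K₁) - inX b * K₁))
            (dX (dX (inX a * K₁.flip) - inX b * K₁.flip)) Y x)) x := fun x _ => by
    refine ((hY x).mul (hasDerivAt_triOp _ _ hYc x)).neg.congr_deriv ?_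
    rw [triOp_sub _ _ _ _ hYc, triOp_inX_mul, BiPoly.eval_diag, mul_sub (inX a),
      dX_sub (inX a * K₁)]
    simp only [BiPoly.at_sub, BiPoly.at_mul, BiPoly.at_inX, BiPoly.at_flip]
    ring
  rw [intervalIntegral.integral_eq_sub_of_hasDerivAt hd
    (Continuous.intervalIntegrable (by fun_prop) _ _), h0]
  -- At `x = 1` only the lower kernel contributes, and expanding its derivative gives the negative
  -- of the boundary expression in `hK₁`. The endpoint `0` is covered by `Y 0 = 0`.
  have h1 : triOp (dX (inX a * K₁) - inX b * K₁) (dX (inX a * K₁.flip) - inX b * K₁.flip) Y 1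
      = 0 := by
    rw [triOp, intervalIntegral.integral_same, add_zero]
    rw [intervalIntegral.integral_congr (g := fun _ => (0 : ℝ)), intervalIntegral.integral_zero]
    intro ξ hξ
    rw [uIcc_of_le zero_le_one] at hξ
    simp only [dX_mul, dX_inX, BiPoly.at_sub, BiPoly.at_add, BiPoly.at_mul, BiPoly.at_inX]
    linear_combination -Y ξ * hK₁ ξ hξ
  rw [h1]; simp

/-- The constant is `2(π/2)² = π²/2`, multiplied by the lower bound `αε` for `aM`. -/
lemma wirtinger_weighted (hα : 0 < α) (hε : 0 < ε)
    (ha : ∀ x ∈ Icc (0 : ℝ) 1, α ≤ a.eval x) (hMε : ∀ x, ε ≤ M.eval x)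
    (hY : ∀ x, HasDerivAt Y (Y₁ x) x) (hY₁ : Continuous Y₁) (h0 : Y 0 = 0) :
    Real.pi ^ 2 / 2 * α * ε * ∫ x in (0 : ℝ)..1, Y x ^ 2
      ≤ 2 * ∫ x in (0 : ℝ)..1, a.eval x * M.eval x * Y₁ x ^ 2 := by
  have hw := wirtinger hY hY₁ h0
  have hmono : ∫ x in (0 : ℝ)..1, α * ε * Y₁ x ^ 2
      ≤ ∫ x in (0 : ℝ)..1, a.eval x * M.eval x * Y₁ x ^ 2 := by
    refine intervalIntegral.integral_mono_on zero_le_one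
      (Continuous.intervalIntegrable (by fun_prop) _ _)
      (Continuous.intervalIntegrable (by fun_prop) _ _) fun x hx => ?_
    have := mul_le_mul (ha x hx) (hMε x) hε.le (hα.le.trans (ha x hx))
    exact mul_le_mul_of_nonneg_right this (sq_nonneg _)
  rw [intervalIntegral.integral_const_mul] at hmono
  have := mul_le_mul_of_nonneg_left hw (mul_pos hα hε).le
  linarith

/-- The derivation only ever differentiates in `x`. The `ξ`-half of `K̂₁` is the transpose of the
same expression formed from the upper kernel. -/
lemma K1hat_eq (a b c : ℝ[X]) (K : BiPoly) :
    K1hat a b c K = (dX (dX (inX a * K) - inX b * K) + inX c * K)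
      + (dX (dX (inX a * K.flip) - inX b * K.flip) + inX c * K.flip).flip := by
  simp only [K1hat, BiPoly.flip_add, BiPoly.flip_sub, BiPoly.flip_mul, BiPoly.flip_dX,
    BiPoly.flip_inX, BiPoly.flip_flip]
  ring

/-- Differentiating the Lyapunov functional along the equation. -/
lemma dissipation (hα : 0 < α) (ha : ∀ x ∈ Icc (0 : ℝ) 1, α ≤ a.eval x) (hε : 0 < ε)
    (hMε : ∀ x, ε ≤ M.eval x)
    (hK₁ : ∀ x ∈ Icc (0 : ℝ) 1,
      (b.eval 1 - (Polynomial.derivative a).eval 1) * K₁.at 1 x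
        - a.eval 1 * (dX K₁).at 1 x = 0)
    (hM : (b.eval 1 - (Polynomial.derivative a).eval 1) * M.eval 1
        - a.eval 1 * (Polynomial.derivative M).eval 1 ≤ 0)
    (hK₂ : ∀ x ∈ Icc (0 : ℝ) 1, K₁.flip.at 0 x = 0)
    (hY : ∀ x, HasDerivAt Y (Y₁ x) x) (hY₁ : Continuous Y₁) (h0 : Y 0 = 0) (h1 : Y₁ 1 = 0)
    (hy₂ : Integrable y₂ vol01)
    (hibp : ∀ g g₁ : ℝ → ℝ, (∀ x, HasDerivAt g (g₁ x) x) → Continuous g₁ →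
        ∫ x in (0 : ℝ)..1, y₂ x * g x
          = Y₁ 1 * g 1 - Y₁ 0 * g 0 - ∫ x in (0 : ℝ)..1, Y₁ x * g₁ x) :
    2 * ∫ x in (0 : ℝ)..1, (a.eval x * y₂ x + b.eval x * Y₁ x + c.eval x * Y x)
        * (M.eval x * Y x + triOp K₁ K₁.flip Y x)
      ≤ ∫ x in (0 : ℝ)..1, Y x * ((Mhat a b c α ε M K₁ K₁.flip).eval x * Y x
        + triOp (K1hat a b c K₁) (K1hat a b c K₁).flip Y x) := by
  have hYc : Continuous Y := continuous_iff_continuousAt.2 fun x => (hY x).continuousAt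
  have hE := integral_multiplier_boundary_nonpos hY hY₁ h0 hM
  have hF := integral_kernel_boundary hY hY₁ h0 hK₁
  have hW := wirtinger_weighted hα hε ha hMε hY hY₁ h0
  set Q₁ := dX (dX (inX a * K₁) - inX b * K₁) + inX c * K₁ with hQ₁
  set Q₂ := dX (dX (inX a * K₁.flip) - inX b * K₁.flip) + inX c * K₁.flip with hQ₂
  have hS : ∫ x in (0 : ℝ)..1, Y x * triOp Q₁ Q₂ Y x
      = ∫ x in (0 : ℝ)..1, Y x * triOp Q₂.flip Q₁.flip Y x := by
    simpa only [integral_vol01] using integral_mul_triOp_flip Q₁ Q₂ hYc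
  have hy₂i : IntervalIntegrable y₂ volume 0 1 :=
    IntegrableOn.intervalIntegrable (by rwa [uIcc_of_le zero_le_one])
  -- Nothing is known about `Y₁ 0`, so the boundary term at `0` must be killed by the kernel: there
  -- only the upper kernel contributes, and it vanishes at `x = 0`.
  have hk0 : triOp (inX a * K₁) (inX a * K₁.flip) Y 0 = 0 := by
    rw [triOp_inX_mul, triOp, intervalIntegral.integral_same, zero_add,
      intervalIntegral.integral_congr (g := fun _ => (0 : ℝ)), intervalIntegral.integral_zero,
      mul_zero]
    intro ξ hξ
    rw [uIcc_of_le zero_le_one] at hξ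
    simp [hK₂ ξ hξ]
  have hI₁ := hibp (triOp (inX a * K₁) (inX a * K₁.flip) Y)
    (triOp (dX (inX a * K₁)) (dX (inX a * K₁.flip)) Y)
    (triOp_flip_deriv_diag a hYc) (by fun_prop)
  have hI₂ := hibp (fun x => (a * M).eval x * Y x)
    (fun x => (Polynomial.derivative (a * M)).eval x * Y x + (a * M).eval x * Y₁ x)
    (fun x => ((a * M).hasDerivAt x).mul (hY x)) (by fun_prop)
  rw [h1, hk0, zero_mul, mul_zero, sub_zero, zero_sub] at hI₁
  simp only [h1, h0, mul_zero, zero_mul, sub_zero, zero_sub] at hI₂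
  have hsplit : ∫ x in (0 : ℝ)..1, (a.eval x * y₂ x + b.eval x * Y₁ x + c.eval x * Y x)
        * (M.eval x * Y x + triOp K₁ K₁.flip Y x)
      = (∫ x in (0 : ℝ)..1, y₂ x * triOp (inX a * K₁) (inX a * K₁.flip) Y x)
        + (∫ x in (0 : ℝ)..1, y₂ x * ((a * M).eval x * Y x))
        + ∫ x in (0 : ℝ)..1, (b.eval x * Y₁ x + c.eval x * Y x)
          * (M.eval x * Y x + triOp K₁ K₁.flip Y x) := by
    rw [← intervalIntegral.integral_add, ← intervalIntegral.integral_add]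
    · congr 1; ext x
      rw [triOp_inX_mul, Polynomial.eval_mul]; ring
    · exact (hy₂i.mul_continuousOn (Continuous.continuousOn (by fun_prop))).add
        (hy₂i.mul_continuousOn (Continuous.continuousOn (by fun_prop)))
    · exact Continuous.intervalIntegrable (by fun_prop) _ _
    · exact hy₂i.mul_continuousOn (Continuous.continuousOn (by fun_prop))
    · exact hy₂i.mul_continuousOn (Continuous.continuousOn (by fun_prop))
  have hL : 2 * ∫ x in (0 : ℝ)..1, (a.eval x * y₂ x + b.eval x * Y₁ x + c.eval x * Y x)
        * (M.eval x * Y x + triOp K₁ K₁.flip Y x)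
      = ∫ x in (0 : ℝ)..1, 2 * ((b.eval x * Y₁ x + c.eval x * Y x)
          * (M.eval x * Y x + triOp K₁ K₁.flip Y x)
        - Y₁ x * ((Polynomial.derivative (a * M)).eval x * Y x + (a * M).eval x * Y₁ x)
        - Y₁ x * triOp (dX (inX a * K₁)) (dX (inX a * K₁.flip)) Y x) := by
    rw [hsplit, hI₁, hI₂, intervalIntegral.integral_const_mul, intervalIntegral.integral_sub,
      intervalIntegral.integral_sub]
    · ring
    all_goals exact Continuous.intervalIntegrable (by fun_prop) _ _
  have hfl : (K1hat a b c K₁).flip = Q₂ + Q₁.flip := by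
    rw [K1hat_eq, BiPoly.flip_add, BiPoly.flip_flip, add_comm]
  -- The direct computation produces `2⟨Y, (Q₁,Q₂)Y⟩`; the difference `t - s` replaces one copy by
  -- its transpose, which yields the kernel `K̂₁ = Q₁ + Q₂.flip`.
  rw [hL, integral_linear_combination (R := fun x => Y x *
      ((Mhat a b c α ε M K₁ K₁.flip).eval x * Y x
        + triOp (K1hat a b c K₁) (K1hat a b c K₁).flip Y x))
    (Real.pi ^ 2 / 2 * α * ε) (L := fun x => 2 * ((b.eval x * Y₁ x + c.eval x * Y x)
          * (M.eval x * Y x + triOp K₁ K₁.flip Y x)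
        - Y₁ x * ((Polynomial.derivative (a * M)).eval x * Y x + (a * M).eval x * Y₁ x)
        - Y₁ x * triOp (dX (inX a * K₁)) (dX (inX a * K₁.flip)) Y x))
    (u := fun x => (Polynomial.derivative (b * M - Polynomial.derivative (a * M))).eval x
        * Y x ^ 2 + (b * M - Polynomial.derivative (a * M)).eval x * (2 * Y x * Y₁ x))
    (v := fun x => Y₁ x * (b.eval x * triOp K₁ K₁.flip Y x
          - triOp (dX (inX a * K₁)) (dX (inX a * K₁.flip)) Y x)
        - Y x * ((dX (inX a * (K₁ - K₁.flip))).diag.eval x * Y x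
          + triOp (dX (dX (inX a * K₁) - inX b * K₁))
            (dX (dX (inX a * K₁.flip) - inX b * K₁.flip)) Y x))
    (s := fun x => Y x * triOp Q₁ Q₂ Y x) (t := fun x => Y x * triOp Q₂.flip Q₁.flip Y x)
    (p := fun x => a.eval x * M.eval x * Y₁ x ^ 2) (q := fun x => Y x ^ 2)
    (by fun_prop) (by fun_prop) (by fun_prop) (by fun_prop) (by fun_prop) (by fun_prop)
    (by fun_prop) _ 0 1]
  · linarith
  · intro x
    rw [hfl, K1hat_eq, ← hQ₁, ← hQ₂, triOp_add _ _ _ _ hYc, hQ₁, hQ₂, triOp_add _ _ _ _ hYc,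
      triOp_inX_mul]
    simp only [Mhat, Polynomial.eval_sub, Polynomial.eval_add, Polynomial.eval_mul,
      Polynomial.eval_C, Polynomial.eval_ofNat, Polynomial.derivative_sub]
    ring

end Dissipation

/-! ### Lyapunov estimates on the operator graph and exponential decay -/

/-- A `C¹` function on the line that represents an element of `D₀` in the graph of the operator. -/
lemma OpGraph.exists_extension {a b c : ℝ[X]} {f g : L2} (h : OpGraph a b c f g) :
    ∃ Y Y₁ y₂ : ℝ → ℝ, (∀ x, HasDerivAt Y (Y₁ x) x) ∧ Continuous Y₁ ∧ Y 0 = 0 ∧ Y₁ 1 = 0 ∧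
      Integrable y₂ vol01 ∧ f =ᵐ[vol01] Y ∧
      (g =ᵐ[vol01] fun x => a.eval x * y₂ x + b.eval x * Y₁ x + c.eval x * Y x) ∧
      ∀ g g₁ : ℝ → ℝ, (∀ x, HasDerivAt g (g₁ x) x) → Continuous g₁ →
        ∫ x in (0 : ℝ)..1, y₂ x * g x
          = Y₁ 1 * g 1 - Y₁ 0 * g 0 - ∫ x in (0 : ℝ)..1, Y₁ x * g₁ x := by
  obtain ⟨y, y₁, y₂, ⟨hH, hf, h0, h1⟩, hg⟩ := h
  obtain ⟨Y, Y₁, hY, hY₁, he, he₁, hy₂, hibp⟩ := hH.exists_extension h0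
  refine ⟨Y, Y₁, y₂, hY, hY₁, ?_, ?_, hy₂, ?_, ?_, hibp⟩
  · rw [he (by simp), h0]
  · rw [he₁ (by simp), h1]
  · filter_upwards [hf, ae_mem_vol01] with x hx hm
    rw [hx, he hm]
  · filter_upwards [hg, ae_mem_vol01] with x hx hm
    rw [hx, he hm, he₁ hm]

lemma Xi.le_triFormVal {d₁ d₂ : ℕ} {ε : ℝ} {M : ℝ[X]} {K₁ K₂ : BiPoly}
    (h : (M, K₁, K₂) ∈ Xi d₁ d₂ ε) {f : L2} {Y : ℝ → ℝ} (hY : Continuous Y)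
    (hf : f =ᵐ[vol01] Y) : ε * ‖f‖ ^ 2 ≤ triFormVal M K₁ K₂ f f := by
  have hn : ‖f‖ ^ 2 = ∫ x in (0 : ℝ)..1, Y x ^ 2 := by
    rw [L2.norm_sq, ← integral_vol01]
    refine integral_congr_ae ?_
    filter_upwards [hf] with x hx
    rw [hx]
  rw [hn, triFormVal_congr M K₁ K₂ hf hf,
    triFormVal_continuous_right M K₁ K₂ (integrable_vol01_of_continuous hY) hY]
  exact Xi.lower_bound h hY

/-- The form of `Ω_s` dominates the left side by `dissipation`, and positivity of the second cone
triple says that this form is at most `-2δ` times the Lyapunov form. -/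
lemma OpGraph.triFormVal_le {a b c M : ℝ[X]} {K₁ : BiPoly} {α ε δ : ℝ} {d₁ d₂ e₁ e₂ : ℕ}
    (hα : 0 < α) (ha : ∀ x ∈ Icc (0 : ℝ) 1, α ≤ a.eval x) (hε : 0 < ε)
    (hP : (M, K₁, K₁.flip) ∈ Xi d₁ d₂ ε)
    (hΩ : -OmegaS a b c α ε (M, K₁, K₁.flip) - (2 * δ) • (M, K₁, K₁.flip) ∈ Xi e₁ e₂ 0)
    (hK₁ : ∀ x ∈ Icc (0 : ℝ) 1,
      (b.eval 1 - (Polynomial.derivative a).eval 1) * K₁.at 1 x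
        - a.eval 1 * (dX K₁).at 1 x = 0)
    (hM : (b.eval 1 - (Polynomial.derivative a).eval 1) * M.eval 1
        - a.eval 1 * (Polynomial.derivative M).eval 1 ≤ 0)
    (hK₂ : ∀ x ∈ Icc (0 : ℝ) 1, K₁.flip.at 0 x = 0)
    {f g : L2} (h : OpGraph a b c f g) :
    2 * triFormVal M K₁ K₁.flip g f ≤ -(2 * δ) * triFormVal M K₁ K₁.flip f f := by
  obtain ⟨Y, Y₁, y₂, hY, hY₁, h0, h1, hy₂, hf, hg, hibp⟩ := h.exists_extension
  have hYc : Continuous Y := continuous_iff_continuousAt.2 fun x => (hY x).continuousAt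
  have hdiss := dissipation (c := c) hα ha hε (Xi.le_eval hP) hK₁ hM hK₂ hY hY₁ h0 h1 hy₂ hibp
  have hgi : Integrable (fun x => a.eval x * y₂ x + b.eval x * Y₁ x + c.eval x * Y x) vol01 :=
    ((integrable_eval_mul a hy₂).add
      (integrable_eval_mul b (integrable_vol01_of_continuous hY₁))).add
      (integrable_eval_mul c (integrable_vol01_of_continuous hYc))
  rw [triFormVal_congr M _ _ hg hf, triFormVal_congr M _ _ hf hf,
    triFormVal_continuous_right _ _ _ hgi hYc,
    triFormVal_continuous_right _ _ _ (integrable_vol01_of_continuous hYc) hYc]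
  refine hdiss.trans ?_
  have hlow := Xi.lower_bound (M := -Mhat a b c α ε M K₁ K₁.flip - (2 * δ) • M)
    (K₁ := -K1hat a b c K₁ - (2 * δ) • K₁)
    (K₂ := -(K1hat a b c K₁).flip - (2 * δ) • K₁.flip) hΩ hYc
  rw [zero_mul] at hlow
  have e : ∀ x, Y x * ((-Mhat a b c α ε M K₁ K₁.flip - (2 * δ) • M).eval x * Y x
      + triOp (-K1hat a b c K₁ - (2 * δ) • K₁) (-(K1hat a b c K₁).flip - (2 * δ) • K₁.flip) Y x)
      = -(2 * δ) * (Y x * (M.eval x * Y x + triOp K₁ K₁.flip Y x))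
        - Y x * ((Mhat a b c α ε M K₁ K₁.flip).eval x * Y x
        + triOp (K1hat a b c K₁) (K1hat a b c K₁).flip Y x) := fun x => by
    rw [triOp_sub _ _ _ _ hYc, triOp_neg, triOp_smul]
    simp only [Polynomial.eval_sub, Polynomial.eval_neg, Polynomial.eval_smul, smul_eq_mul]
    ring
  simp only [e] at hlow
  rw [intervalIntegral.integral_sub (Continuous.intervalIntegrable (by fun_prop) _ _)
    (Continuous.intervalIntegrable (by fun_prop) _ _), intervalIntegral.integral_const_mul] at hlow
  linarith

/-- Grönwall's inequality for a quadratic functional along a curve in a normed space. -/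
lemma quadratic_exp_decay {E : Type*} [NormedAddCommGroup E] [NormedSpace ℝ E]
    (Φ : E →L[ℝ] E →L[ℝ] ℝ) (hsymm : ∀ f g, Φ f g = Φ g f) {w : ℝ → E} {κ : ℝ}
    (hw : ContinuousOn w (Ici 0)) (hd : ∀ t, 0 < t → DifferentiableAt ℝ w t)
    (hdiss : ∀ t, 0 < t → 2 * Φ (deriv w t) (w t) ≤ -κ * Φ (w t) (w t)) {t : ℝ} (ht : 0 ≤ t) :
    Φ (w t) (w t) ≤ Φ (w 0) (w 0) * Real.exp (-κ * t) := by
  set V : ℝ → ℝ := fun t => Real.exp (κ * t) * Φ (w t) (w t) with hV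
  have hVc : ContinuousOn V (Ici 0) := by
    have : ContinuousOn (fun t => Φ (w t) (w t)) (Ici 0) :=
      (Φ.continuous.comp_continuousOn hw).clm_apply hw
    fun_prop
  have hVd : ∀ t, 0 < t → HasDerivAt V
      (Real.exp (κ * t) * (κ * Φ (w t) (w t) + 2 * Φ (deriv w t) (w t))) t := fun t ht => by
    have hwt := (hd t ht).hasDerivAt
    have h1 : HasDerivAt (fun t => Φ (w t) (w t))
        (Φ (deriv w t) (w t) + Φ (w t) (deriv w t)) t :=
      (Φ.hasFDerivAt.comp_hasDerivAt t hwt).clm_apply hwt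
    have h2 : HasDerivAt (fun t => Real.exp (κ * t)) (Real.exp (κ * t) * κ) t := by
      simpa using ((hasDerivAt_id t).const_mul κ).exp
    refine (h2.mul h1).congr_deriv ?_
    rw [hsymm (w t) (deriv w t)]; ring
  -- The derivative is available only for positive times; continuity at `0` carries monotonicity to
  -- the initial value.
  have hanti : AntitoneOn V (Ici 0) := by
    refine antitoneOn_of_deriv_nonpos (convex_Ici 0) hVc ?_ ?_
    all_goals
      intro s hs
      rw [interior_Ici, mem_Ioi] at hs
    · exact (hVd s hs).differentiableAt.differentiableWithinAt
    · rw [(hVd s hs).deriv]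
      exact mul_nonpos_of_nonneg_of_nonpos (Real.exp_pos _).le (by linarith [hdiss s hs])
  have h := hanti (mem_Ici.2 le_rfl) (mem_Ici.2 ht) ht
  simp only [hV, mul_zero, Real.exp_zero, one_mul] at h
  calc Φ (w t) (w t) = Real.exp (κ * t) * Φ (w t) (w t) * Real.exp (-κ * t) := by
        rw [mul_right_comm, ← Real.exp_add]; simp
    _ ≤ _ := mul_le_mul_of_nonneg_right h (Real.exp_pos _).le

end ParabolicLMI

/-! ### The stability theorem -/

theorem theorem2 (a b c : ℝ[X]) (α : ℝ) (hα : 0 < α)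
    (ha : ∀ x ∈ Icc (0 : ℝ) 1, α ≤ a.eval x)
    (ε δ : ℝ) (hε : 0 < ε) (hδ : 0 < δ) (d₁ d₂ e₁ e₂ : ℕ)
    (M : ℝ[X]) (K₁ K₂ : BiPoly)
    (hP : (M, K₁, K₂) ∈ Xi d₁ d₂ ε)
    (hΩ : -OmegaS a b c α ε (M, K₁, K₂) - (2 * δ) • (M, K₁, K₂) ∈ Xi e₁ e₂ 0)
    (hK₁ : ∀ x ∈ Icc (0 : ℝ) 1,
      (b.eval 1 - (Polynomial.derivative a).eval 1) * K₁.at 1 x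
        - a.eval 1 * (dX K₁).at 1 x = 0)
    (hM : (b.eval 1 - (Polynomial.derivative a).eval 1) * M.eval 1
        - a.eval 1 * (Polynomial.derivative M).eval 1 ≤ 0)
    (hK₂ : ∀ x ∈ Icc (0 : ℝ) 1, K₂.at 0 x = 0) :
    ∃ γ : ℝ, 0 < γ ∧ ∀ w : ℝ → L2, IsClassicalSolution a b c w → w 0 ∈ D0 →
      ∀ t : ℝ, 0 < t → ‖w t‖ ≤ γ * ‖w 0‖ * Real.exp (-δ * t) := by
  obtain rfl : K₂ = K₁.flip := by
    obtain ⟨_, _, _, _, _, _, -, -, -, h⟩ := hP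
    exact h
  obtain ⟨Φ, hΦ⟩ := exists_continuousBilinear_triForm M K₁ K₁.flip
  -- The constant is the root of the ratio of the upper and lower bounds of the form; adding `1`
  -- gives positivity without examining `‖Φ‖`.
  refine ⟨Real.sqrt ((‖Φ‖ + 1) / ε), Real.sqrt_pos.2 (by positivity), fun w hw _ t ht => ?_⟩
  have hdecay := quadratic_exp_decay Φ (fun f g => by rw [hΦ, hΦ, triFormVal_symm])
    hw.continuousOn
    (fun s hs => (hw.contDiffOn.differentiableOn one_ne_zero).differentiableAt (Ioi_mem_nhds hs))
    (fun s hs => by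
      rw [hΦ, hΦ]
      exact (hw.equation s hs).triFormVal_le hα ha hε hP hΩ hK₁ hM hK₂) ht.le
  have hlow : ε * ‖w t‖ ^ 2 ≤ Φ (w t) (w t) := by
    obtain ⟨Y, Y₁, y₂, hY, -, -, -, -, hf, -, -⟩ := (hw.equation t ht).exists_extension
    rw [hΦ]
    exact Xi.le_triFormVal hP (continuous_iff_continuousAt.2 fun x => (hY x).continuousAt) hf
  have hup : Φ (w 0) (w 0) ≤ (‖Φ‖ + 1) * ‖w 0‖ ^ 2 := by
    have := (le_abs_self _).trans (Φ.le_opNorm₂ (w 0) (w 0))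
    nlinarith [sq_nonneg ‖w 0‖]
  -- Comparing squares halves the rate `2δ` of the functional to the rate `δ` of the norm.
  refine abs_le_of_sq_le_sq' ?_ (by positivity) |>.2
  rw [mul_pow, mul_pow, Real.sq_sqrt (by positivity), ← Real.exp_nat_mul]
  have hexp : Real.exp (-(2 * δ) * t) = Real.exp (((2 : ℕ) : ℝ) * (-δ * t)) := by
    congr 1; push_cast; ring
  rw [← hexp, div_mul_eq_mul_div, div_mul_eq_mul_div, le_div_iff₀ hε, mul_comm]
  exact hlow.trans (hdecay.trans (mul_le_mul_of_nonneg_right hup (Real.exp_pos _).le))
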